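/- Let $N\ge 3$. Let $\mathcal A_N$ be the complex Lie algebra generated by $e_1,\dots,e_N$ (indices modulo $N$) subject to the relations $$[e_i,[e_i,e_j]]=e_j\ \text{ if } j\equiv i\pm1 \pmod N,\qquad [e_i,e_j]=0\ \text{ otherwise}$$ (that is, according to whether $i$ and $j$ are adjacent in the Dynkin graph of type $A^{(1)}_{N-1}$, the $N$-cycle). For $1\le i\le N$ and $r\ge 1$ let $S_i(r)=[e_i,[e_{i+1},[\dots,[e_{i+r-2},e_{i+r-1}]\dots]]]\in\mathcal A_N$, so that $S_i(1)=e_i$. Let $\mathcal L=\mathbb C[t,t^{-1}]\otimes \mathfrak{sl}(N)$, let $E_{ij}$ be the matrix units and $H_i=E_{ii}-E_{i+1,i+1}$, and let $\omega$ be the involutive automorphism of the complex Lie algebra $\mathcal L$ given by $$\omega(t^nE_{ij})=(-1)^{i+j+1+nN}\,t^{-n}E_{ji}\ (i\ne j),\qquad \omega(t^nH_i)=(-1)^{1+nN}\,t^{-n}H_i\ (1\le i\le N-1),\qquad n\in\mathbb Z.$$ Let $\tilde{\mathcal A}_N=\{x\in\mathcal L:\omega(x)=x\}$. Put $u_m=(t-(-1)^Nt^{-1})(t+(-1)^Nt^{-1})^{m-1}$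 for $m\ge1$, and for $1\le i\le N$ define the following elements of $\mathcal L$ (matrix indices modulo $N$): * for $1\le k\le N-1$: $\tilde S_i(k)=E_{i,i+k}+(-1)^{k+1}E_{i+k,i}$ if $i+k\le N$, and $\tilde S_i(k)=t\,E_{i,i+k-N}+(-1)^{k+1}t^{-1}E_{i+k-N,i}$ if $i+k\ge N+1$; * for $1\le k\le N-1$, $m\ge1$: $\tilde S_i(Nm+k)=u_m\,(E_{i,i+k}+(-1)^{k}E_{i+k,i})$ if $i+k\le N$, and $\tilde S_i(Nm+k)=u_m\,(t\,E_{i,i+k-N}+(-1)^{k}t^{-1}E_{i+k-N,i})$ if $i+k\ge N+1$; * for $m\ge1$: $\tilde S_i(Nm)=u_m\,(E_{ii}-E_{i+1,i+1})$. Then there is a unique homomorphism of complex Lie algebras $\pi:\mathcal A_N\to\tilde{\mathcal A}_N$ with $\pi(e_i)=\tilde S_i(1)$ for $i=1,\dots,N$. It is an isomorphism of Lie algebras, and $\pi(S_i(r))=\tilde S_i(r)$ for all $1\le i\le N$ and all $r\ge1$. -/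

import Mathlib

open scoped TensorProduct LaurentPolynomial
open LieAlgebra.SpecialLinear (sl)

/- Conventions. The vertices `1, …, N` of the cycle (and the rows and columns of the `N × N`
matrices) are the elements of `Fin N`: the label `i` is the element of `Fin N` with value
`i - 1`. Signs such as `(-1)^(i+j+1)` do not see this shift, and `i + k ≤ N` in labels is
`i.val + k < N`. -/

namespace SlOnsager

/-- The cyclic shift `i ↦ i + k` of indices modulo `N`. -/
def rot {N : ℕ} (i : Fin N) (k : ℕ) : Fin N :=
  ⟨(i.val + k) % N, Nat.mod_lt _ i.pos⟩

/-- Adjacency in the cycle with vertices `Fin N`, the Dynkin graph of type `A_{N-1}^{(1)}`. -/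
def Adjacent {N : ℕ} (i j : Fin N) : Prop :=
  j = rot i 1 ∨ i = rot j 1

/-! ### The algebra given by generators and relations -/

/-- The generalized Dolan–Grady relations, as elements of the free Lie algebra. -/
def relations (N : ℕ) : Set (FreeLieAlgebra ℂ (Fin N)) :=
  {x | ∃ i j : Fin N, Adjacent i j ∧
      x = ⁅FreeLieAlgebra.of ℂ i, ⁅FreeLieAlgebra.of ℂ i, FreeLieAlgebra.of ℂ j⁆⁆
        - FreeLieAlgebra.of ℂ j} ∪
  {x | ∃ i j : Fin N, ¬ Adjacent i j ∧
      x = ⁅FreeLieAlgebra.of ℂ i, FreeLieAlgebra.of ℂ j⁆}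

/-- The ideal generated by the relations. -/
noncomputable def relIdeal (N : ℕ) : LieIdeal ℂ (FreeLieAlgebra ℂ (Fin N)) :=
  LieSubmodule.lieSpan ℂ (FreeLieAlgebra ℂ (Fin N)) (relations N)

/-- The `sl(N)` Onsager algebra `𝒜_N`. -/
abbrev OnsagerAlgebra (N : ℕ) : Type :=
  FreeLieAlgebra ℂ (Fin N) ⧸ relIdeal N

/-- The generators `e_i`. -/
noncomputable def e {N : ℕ} (i : Fin N) : OnsagerAlgebra N :=
  LieSubmodule.Quotient.mk (FreeLieAlgebra.of ℂ i)

/-- The string `S_i(r) = [e_i,[e_{i+1},[…,e_{i+r-1}]…]]`; the string of length `0` is `0`. -/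
noncomputable def string {N : ℕ} : Fin N → ℕ → OnsagerAlgebra N
  | _, 0 => 0
  | i, 1 => e i
  | i, r + 2 => ⁅e i, string (rot i 1) (r + 1)⁆

/-! ### The loop algebra and its involution -/

/-- The loop algebra `ℂ[t,t⁻¹] ⊗ sl(N)`. -/
abbrev LoopSl (N : ℕ) : Type :=
  ℂ[T;T⁻¹] ⊗[ℂ] sl (Fin N) ℂ

/-- The matrix unit `E_{ij}`, `i ≠ j`, as an element of `sl(N)` (only used for `i ≠ j`). -/
noncomputable def E {N : ℕ} (i j : Fin N) : sl (Fin N) ℂ :=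
  if h : i ≠ j then LieAlgebra.SpecialLinear.single i j h 1 else 0

theorem coe_E {N : ℕ} {i j : Fin N} (h : i ≠ j) :
    (E i j : Matrix (Fin N) (Fin N) ℂ) = Matrix.single i j 1 := by
  simp [E, h]

/-- `H i = E_{ii} - E_{i+1,i+1}`, with cyclic indices. -/
noncomputable def H {N : ℕ} (i : Fin N) : sl (Fin N) ℂ :=
  LieAlgebra.SpecialLinear.singleSubSingle i (rot i 1) 1

/-- The automorphism `t^n ↦ (-1)^{nN} t^{-n}` of the Laurent polynomials. -/
noncomputable def omega₁ (N : ℕ) : ℂ[T;T⁻¹] →ₐ[ℂ] ℂ[T;T⁻¹] :=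
  AddMonoidAlgebra.lift ℂ ℂ[T;T⁻¹] ℤ
    { toFun := fun n => ((-1 : ℂ) ^ (n.toAdd * (N : ℤ))) • LaurentPolynomial.T (-n.toAdd)
      map_one' := by simp
      map_mul' := by
        intro m n
        rw [smul_mul_smul_comm, ← LaurentPolynomial.T_add, ← zpow_add₀ (by norm_num)]
        congr 2
        · simp only [toAdd_mul]; ring
        · simp only [toAdd_mul]; ring }

theorem omega₁_T (N : ℕ) (n : ℤ) :
    omega₁ N (LaurentPolynomial.T n)
      = ((-1 : ℂ) ^ (n * (N : ℤ))) • LaurentPolynomial.T (-n) := by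
  rw [omega₁, LaurentPolynomial.T, AddMonoidAlgebra.lift_single, one_smul]
  rfl

/-- The automorphism of `sl(N)` given on matrices by `(a_{ij}) ↦ ((-1)^{i+j+1} a_{ji})`. -/
noncomputable def omega₂ (N : ℕ) : sl (Fin N) ℂ →ₗ⁅ℂ⁆ sl (Fin N) ℂ where
  toFun X := ⟨Matrix.of fun i j : Fin N => (-1 : ℂ) ^ (i.val + j.val + 1) * X.val j i, by
    have h : Matrix.trace X.val = 0 := X.2
    change Matrix.trace (Matrix.of fun i j : Fin N =>
      (-1 : ℂ) ^ (i.val + j.val + 1) * X.val j i) = 0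
    simp only [Matrix.trace, Matrix.diag_apply, Matrix.of_apply] at h ⊢
    have : ∀ i : Fin N, (-1 : ℂ) ^ (i.val + i.val + 1) = -1 := fun i =>
      Odd.neg_one_pow ⟨i.val, by ring⟩
    simp [this, h]⟩
  map_add' X Y := by
    ext i j
    simp [mul_add]
  map_smul' c X := by
    ext i j
    simp [mul_left_comm]
  map_lie' := by
    intro X Y
    ext i j
    simp only [LieAlgebra.SpecialLinear.sl_bracket, Matrix.of_apply, Matrix.sub_apply,
      Matrix.mul_apply, mul_sub, Finset.mul_sum]
    rw [← Finset.sum_sub_distrib, ← Finset.sum_sub_distrib]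
    refine Finset.sum_congr rfl fun k _ => ?_
    have h : (-1 : ℂ) ^ (i.val + k.val + 1) * (-1 : ℂ) ^ (k.val + j.val + 1)
        = -(-1 : ℂ) ^ (i.val + j.val + 1) := by
      rw [← pow_add, show i.val + k.val + 1 + (k.val + j.val + 1)
        = (i.val + j.val + 1) + 1 + 2 * k.val by ring, pow_add, pow_succ, pow_mul]
      simp
    linear_combination
      (Y.val k i * X.val j k - X.val k i * Y.val j k) * h

theorem omega₂_apply {N : ℕ} (X : sl (Fin N) ℂ) (i j : Fin N) :
    (omega₂ N X).val i j = (-1 : ℂ) ^ (i.val + j.val + 1) * X.val j i := rfl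

theorem omega₂_E {N : ℕ} {i j : Fin N} (h : i ≠ j) :
    omega₂ N (E i j) = (-1 : ℂ) ^ (i.val + j.val + 1) • E j i := by
  ext a b
  rw [omega₂_apply, coe_E h]
  change _ = (-1 : ℂ) ^ (i.val + j.val + 1) * (E j i).val a b
  rw [coe_E h.symm]
  simp only [Matrix.single_apply]
  by_cases h1 : i = b <;> by_cases h2 : j = a <;> simp [h1, h2, add_comm]

theorem omega₂_H {N : ℕ} (i : Fin N) : omega₂ N (H i) = -H i := by
  ext a b
  have hd : ∀ c : Fin N, (-1 : ℂ) ^ (c.val + c.val + 1) = -1 := fun c =>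
    Odd.neg_one_pow ⟨c.val, by ring⟩
  rw [omega₂_apply]
  by_cases hab : a = b
  · subst hab
    rw [hd]
    simp [H]
  · have h0 : ∀ c d : Fin N, c ≠ d → (H i).val c d = 0 := by
      intro c d hcd
      simp only [H, LieAlgebra.SpecialLinear.val_singleSubSingle, Matrix.sub_apply,
        Matrix.single_apply]
      rw [if_neg (by rintro ⟨rfl, rfl⟩; exact hcd rfl),
        if_neg (by rintro ⟨rfl, rfl⟩; exact hcd rfl), sub_zero]
    rw [h0 b a (Ne.symm hab)]
    simp [h0 a b hab]

/-- The involution `ω` of the loop algebra,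
`t^n E_{ij} ↦ (-1)^{i+j+1+nN} t^{-n} E_{ji}`, `t^n H_i ↦ (-1)^{1+nN} t^{-n} H_i`. -/
noncomputable def omega (N : ℕ) : LoopSl N →ₗ⁅ℂ⁆ LoopSl N :=
  LieAlgebra.ExtendScalars.map (omega₁ N) (omega₂ N)

theorem omega_E {N : ℕ} {i j : Fin N} (h : i ≠ j) (n : ℤ) :
    omega N (LaurentPolynomial.T n ⊗ₜ E i j)
      = (-1 : ℂ) ^ ((i.val : ℤ) + j.val + 1 + n * N) •
          (LaurentPolynomial.T (-n) ⊗ₜ[ℂ] E j i) := by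
  rw [omega, LieAlgebra.ExtendScalars.map_apply_tmul, omega₁_T, omega₂_E h,
    TensorProduct.smul_tmul_smul, zpow_add₀ (by norm_num), mul_comm]
  norm_cast

theorem omega_H {N : ℕ} (i : Fin N) (n : ℤ) :
    omega N (LaurentPolynomial.T n ⊗ₜ H i)
      = (-1 : ℂ) ^ (1 + n * N) • (LaurentPolynomial.T (-n) ⊗ₜ[ℂ] H i) := by
  rw [omega, LieAlgebra.ExtendScalars.map_apply_tmul, omega₁_T, omega₂_H,
    zpow_add₀ (by norm_num), TensorProduct.tmul_neg, ← TensorProduct.smul_tmul', zpow_one,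
    neg_one_mul]
  exact (neg_smul ((-1 : ℂ) ^ (n * (N : ℤ)))
    (LaurentPolynomial.T (-n) ⊗ₜ[ℂ] H i : LoopSl N)).symm

theorem omega_omega {N : ℕ} (x : LoopSl N) : omega N (omega N x) = x := by
  have h1 : ∀ f : ℂ[T;T⁻¹], omega₁ N (omega₁ N f) = f := by
    intro f
    induction f using LaurentPolynomial.induction_on' with
    | add p q hp hq => rw [map_add, map_add, hp, hq]
    | C_mul_T n a =>
      rw [← LaurentPolynomial.smul_eq_C_mul, map_smul, map_smul, omega₁_T, map_smul, omega₁_T,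
        smul_smul ((-1 : ℂ) ^ _), neg_neg, ← zpow_add₀ (by norm_num : (-1 : ℂ) ≠ 0)]
      simp
  have h2 : ∀ X : sl (Fin N) ℂ, omega₂ N (omega₂ N X) = X := by
    intro X
    ext i j
    rw [omega₂_apply, omega₂_apply, ← mul_assoc, ← pow_add, Even.neg_one_pow, one_mul]
    exact ⟨i.val + j.val + 1, by ring⟩
  induction x using TensorProduct.induction_on with
  | zero => simp
  | tmul f X => simp [omega, h1, h2]
  | add x y hx hy => rw [map_add, map_add, hx, hy]

/-- The fixed-point subalgebra `𝒜̃_N` of `ω`. -/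
noncomputable def fixedSubalgebra (N : ℕ) : LieSubalgebra ℂ (LoopSl N) where
  carrier := {x | omega N x = x}
  add_mem' {x y} hx hy := by
    simp only [Set.mem_ofPred_eq] at hx hy ⊢
    rw [map_add, hx, hy]
  zero_mem' := map_zero _
  smul_mem' c x hx := by
    simp only [Set.mem_ofPred_eq] at hx ⊢
    rw [map_smul, hx]
  lie_mem' {x y} hx hy := by
    change omega N ⁅x, y⁆ = ⁅x, y⁆
    rw [LieHom.map_lie, show omega N x = x from hx, show omega N y = y from hy]

theorem mem_fixedSubalgebra {N : ℕ} {x : LoopSl N} :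
    x ∈ fixedSubalgebra N ↔ omega N x = x := Iff.rfl

/-! ### The explicit elements -/

/-- The Laurent polynomial `(t - (-1)^N t⁻¹) (t + (-1)^N t⁻¹)^(m-1)`, for `m ≥ 1`. -/
noncomputable def U (N m : ℕ) : ℂ[T;T⁻¹] :=
  (LaurentPolynomial.T 1 - (-1) ^ N * LaurentPolynomial.T (-1)) *
    (LaurentPolynomial.T 1 + (-1) ^ N * LaurentPolynomial.T (-1)) ^ (m - 1)

/-- The explicit elements `S̃_i(r)` for `r ≥ 1`. Here `r = N m + k` with `0 ≤ k ≤ N - 1`,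
and `i + k` is taken modulo `N` in `rot i k`. -/
noncomputable def sTilde {N : ℕ} (i : Fin N) (r : ℕ) : LoopSl N :=
  let m := r / N
  let k := r % N
  if k = 0 then
    U N m ⊗ₜ[ℂ] H i
  else if m = 0 then
    if i.val + k < N then
      1 ⊗ₜ[ℂ] E i (rot i k) + (-1 : ℂ) ^ (k + 1) • (1 ⊗ₜ[ℂ] E (rot i k) i)
    else
      LaurentPolynomial.T 1 ⊗ₜ[ℂ] E i (rot i k)
        + (-1 : ℂ) ^ (k + 1) • (LaurentPolynomial.T (-1) ⊗ₜ[ℂ] E (rot i k) i)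
  else
    if i.val + k < N then
      U N m ⊗ₜ[ℂ] E i (rot i k) + (-1 : ℂ) ^ k • (U N m ⊗ₜ[ℂ] E (rot i k) i)
    else
      (U N m * LaurentPolynomial.T 1) ⊗ₜ[ℂ] E i (rot i k)
        + (-1 : ℂ) ^ k • ((U N m * LaurentPolynomial.T (-1)) ⊗ₜ[ℂ] E (rot i k) i)

end SlOnsager

namespace SlOnsager

/-! ### Conjugation by a quarter turn -/

section Conjugation

variable {L : Type*} [LieRing L] [LieAlgebra ℂ L]

/-! Multiplying the generators by `Complex.I` turns the relations into `⁅g, ⁅g, h⁆⁆ = -h` for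
neighbours. On generators `ad g` then acts as a rotation or as zero, and the quarter turn `exp (π /
2 • ad g)` is given by the finite formula `twist`. The twisted family satisfies the same relations
(`IsDolanGrady.twist`), so the presentation alone yields endomorphisms `T l`. These satisfy the
braid relations (`T_braid`, `T_comm`), and their squares are sign automorphisms.

Hence the affine symmetric group acts up to signs. Moving the generators around gives real root
vectors `root i j`, indexed by integers distinct modulo `N` up to simultaneous shift by `N`;
`T_root` says that `T l` permutes them up to an explicit sign. Reflections reduce every product of
two root vectors sharing an index to the smallest triple, so the root vectors multiply like `E_{xy}
- E_{yx}` (`lie_root`), and those with four distinct residues commute (`lie_root_of_disjoint`). The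
brackets `imag n i j` are additive in the pair `i, j`, depend only on residues and are odd in `n`.
Real and imaginary root vectors together span the algebra (`fullSpan_eq_top`), which bounds its size
from above.

In the loop algebra the elements `loopRoot i j` are fixed by `omega` and obey the same rules, which
gives `π`. A linear map `sectionMap` back from the whole loop algebra satisfies `sectionMap ∘ π = 2`
on the spanning vectors and `π ∘ sectionMap = 1 + omega`. The first identity gives injectivity, the
second surjectivity onto the fixed points. The string formula follows from the single bracket
computation `lie_sTilde`. -/

theorem exists_derivation_eq_lie (d : L) : ∃ δ : L →ₗ[ℂ] L, (∀ x, ⁅d, x⁆ = δ x) ∧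
    ∀ x y, δ ⁅x, y⁆ = ⁅δ x, y⁆ + ⁅x, δ y⁆ :=
  ⟨(LieAlgebra.ad ℂ L d : L →ₗ[ℂ] L), fun _ => rfl, fun x y => leibniz_lie d x y⟩

/-- Apply `δ ^ 2` to `⁅a, b⁆ = 0`; the Leibniz rule leaves `2 • ⁅δ a, δ b⁆ - 2 • ⁅a, b⁆`. -/
theorem lie_conj_comm {d a b : L} (ha : ⁅d, ⁅d, a⁆⁆ = -a) (hb : ⁅d, ⁅d, b⁆⁆ = -b)
    (h : ⁅a, b⁆ = 0) : ⁅⁅d, a⁆, ⁅d, b⁆⁆ = 0 := by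
  obtain ⟨δ, h1, h2⟩ := exists_derivation_eq_lie d
  simp only [h1] at ha hb ⊢
  have h3 : δ (δ ⁅a, b⁆) = 0 := by rw [h, map_zero, map_zero]
  simp only [h2, map_add, ha, hb, neg_lie, lie_neg] at h3
  rw [h] at h3
  have : (2 : ℂ) • ⁅δ a, δ b⁆ = 0 := by linear_combination (norm := module) h3
  simpa using this

/-- On a triple bracket `δ` is a sum `p + q + r` of commuting operators, each of square `-1`, so `6
p q r = δ ^ 3 + 7 δ`. Evaluating the right side on `-b` gives `-6 • δ b`. -/
theorem lie_conj_adj {d a b : L} (ha : ⁅d, ⁅d, a⁆⁆ = -a) (hb : ⁅d, ⁅d, b⁆⁆ = -b)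
    (h : ⁅a, ⁅a, b⁆⁆ = -b) : ⁅⁅d, a⁆, ⁅⁅d, a⁆, ⁅d, b⁆⁆⁆ = -⁅d, b⁆ := by
  obtain ⟨δ, hd, hδ⟩ := exists_derivation_eq_lie d
  simp only [hd] at ha hb ⊢
  have h1 : δ ⁅a, ⁅a, b⁆⁆ = -δ b := by rw [h, map_neg]
  have h2 : δ (δ ⁅a, ⁅a, b⁆⁆) = b := by rw [h1, map_neg, hb, neg_neg]
  have h3 : δ (δ (δ ⁅a, ⁅a, b⁆⁆)) = δ b := by rw [h2]
  simp only [hδ, lie_add, map_add, map_neg, ha, hb, neg_lie, lie_neg] at h1 h2 h3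
  have : (6 : ℂ) • ⁅δ a, ⁅δ a, δ b⁆⁆ = (6 : ℂ) • (-δ b) := by
    linear_combination (norm := module) h3 + (7 : ℂ) • h1
  exact smul_right_injective L (by norm_num : (6 : ℂ) ≠ 0) this

/-- Here `δ b = 0`, so `δ ^ 2` kills `⁅a, ⁅a, b⁆⁆`; expanding gives `2 • ⁅δ a, ⁅δ a, b⁆⁆ = 2 • ⁅a,
⁅a, b⁆⁆`. -/
theorem lie_conj_adj_left {d a b : L} (ha : ⁅d, ⁅d, a⁆⁆ = -a) (hb : ⁅d, b⁆ = 0)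
    (h : ⁅a, ⁅a, b⁆⁆ = -b) : ⁅⁅d, a⁆, ⁅⁅d, a⁆, b⁆⁆ = -b := by
  obtain ⟨δ, hd, hδ⟩ := exists_derivation_eq_lie d
  simp only [hd] at ha hb ⊢
  have h2 : δ (δ ⁅a, ⁅a, b⁆⁆) = 0 := by rw [h, map_neg, hb, neg_zero, map_zero]
  simp only [hδ, map_add, ha, hb, neg_lie, lie_neg, lie_zero, add_zero] at h2
  rw [h] at h2
  have : (2 : ℂ) • ⁅δ a, ⁅δ a, b⁆⁆ = (2 : ℂ) • (-b) := by
    linear_combination (norm := module) h2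
  exact smul_right_injective L (by norm_num : (2 : ℂ) ≠ 0) this

omit [LieAlgebra ℂ L] in
theorem lie_conj_adj_right {d a b : L} (hb : ⁅b, d⁆ = 0)
    (h : ⁅b, ⁅b, a⁆⁆ = -a) : ⁅b, ⁅b, ⁅d, a⁆⁆⁆ = -⁅d, a⁆ := by
  have hb' : ∀ x : L, ⁅b, ⁅d, x⁆⁆ = ⁅d, ⁅b, x⁆⁆ := fun x => by
    rw [leibniz_lie b d x, hb, zero_lie, zero_add]
  rw [hb', hb', h, lie_neg]

end Conjugation

/-! ### Dolan–Grady families and their twists -/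

/-- Elements of a Lie algebra indexed by a cycle that satisfy the Dolan–Grady relations in the
compact normalisation `⁅g i, ⁅g i, g j⁆⁆ = -g j` for adjacent `i` and `j`. -/
structure IsDolanGrady {N : ℕ} {L : Type*} [LieRing L] (g : ZMod N → L) : Prop where
  succ : ∀ i, ⁅g i, ⁅g i, g (i + 1)⁆⁆ = -g (i + 1)
  pred : ∀ i, ⁅g (i + 1), ⁅g (i + 1), g i⁆⁆ = -g i
  comm : ∀ i j, j ≠ i + 1 → i ≠ j + 1 → ⁅g i, g j⁆ = 0

/-- The images of the `g m` under the exponential of `π / 2 • ad (g l)`. -/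
def twist {N : ℕ} {L : Type*} [LieRing L] (g : ZMod N → L) (l m : ZMod N) : L :=
  if m = l + 1 ∨ l = m + 1 then ⁅g l, g m⁆ else g m

section
variable {N : ℕ} {L : Type*} [LieRing L] {g : ZMod N → L}

theorem twist_adj {l m : ZMod N} (h : m = l + 1 ∨ l = m + 1) : twist g l m = ⁅g l, g m⁆ :=
  if_pos h

theorem twist_of_not_adj {l m : ZMod N} (h : ¬(m = l + 1 ∨ l = m + 1)) : twist g l m = g m :=
  if_neg h

namespace IsDolanGrady

theorem adj (hg : IsDolanGrady g) {i j : ZMod N} (h : j = i + 1 ∨ i = j + 1) :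
    ⁅g i, ⁅g i, g j⁆⁆ = -g j := by
  rcases h with rfl | rfl
  · exact hg.succ i
  · exact hg.pred j

theorem comm' (hg : IsDolanGrady g) {i j : ZMod N} (h : ¬(j = i + 1 ∨ i = j + 1)) :
    ⁅g i, g j⁆ = 0 :=
  hg.comm i j (fun h' => h (Or.inl h')) (fun h' => h (Or.inr h'))

theorem of_adj (h1 : ∀ i j : ZMod N, (j = i + 1 ∨ i = j + 1) → ⁅g i, ⁅g i, g j⁆⁆ = -g j)
    (h2 : ∀ i j : ZMod N, ¬(j = i + 1 ∨ i = j + 1) → ⁅g i, g j⁆ = 0) : IsDolanGrady g where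
  succ i := h1 i (i + 1) (Or.inl rfl)
  pred i := h1 (i + 1) i (Or.inr rfl)
  comm i j h h' := h2 i j (by tauto)

theorem twist [LieAlgebra ℂ L] (h10 : (1 : ZMod N) ≠ 0) (hg : IsDolanGrady g) (l : ZMod N) :
    IsDolanGrady (twist g l) := by
  have hne : ∀ m : ZMod N, m ≠ m + 1 := fun m h => h10 (by linear_combination -h)
  have hll : ¬(l = l + 1 ∨ l = l + 1) := by simpa using hne l
  refine of_adj (fun i j hij => ?_) (fun i j hij => ?_)
  · by_cases hi : i = l + 1 ∨ l = i + 1 <;> by_cases hj : j = l + 1 ∨ l = j + 1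
    -- Both neighbours of `l` are adjacent to each other only in the triangle `N = 3`.
    · rw [twist_adj hi, twist_adj hj]
      exact lie_conj_adj (hg.adj hi) (hg.adj hj) (hg.adj hij)
    · rw [twist_adj hi, twist_of_not_adj hj]
      exact lie_conj_adj_left (hg.adj hi) (hg.comm' hj) (hg.adj hij)
    · rw [twist_of_not_adj hi, twist_adj hj]
      exact lie_conj_adj_right (hg.comm' fun h => hi h.symm) (hg.adj hij)
    · rw [twist_of_not_adj hi, twist_of_not_adj hj]
      exact hg.adj hij
  · by_cases hi : i = l + 1 ∨ l = i + 1 <;> by_cases hj : j = l + 1 ∨ l = j + 1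
    · rw [twist_adj hi, twist_adj hj]
      exact lie_conj_comm (hg.adj hi) (hg.adj hj) (hg.comm' hij)
    · rw [twist_adj hi, twist_of_not_adj hj, lie_lie, hg.comm' hij, hg.comm' hj, lie_zero,
        lie_zero, sub_zero]
    · rw [twist_of_not_adj hi, twist_adj hj, leibniz_lie, hg.comm' hij, lie_zero, add_zero,
        hg.comm' fun h => hi h.symm, zero_lie]
    · rw [twist_of_not_adj hi, twist_of_not_adj hj]
      exact hg.comm' hij

/-- The relations are quadratic in `g i`, so signs cancel. The product form of the sign is chosen
because the root vector of a pair `i, j` then scales by `ε i * ε j`. -/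
theorem smul_sign [LieAlgebra ℂ L] (hg : IsDolanGrady g) {ε : ZMod N → ℂ}
    (hε : ∀ m, ε m * ε m = 1) : IsDolanGrady fun m => (ε m * ε (m + 1)) • g m := by
  refine of_adj (fun i j hij => ?_) (fun i j hij => ?_)
  · simp only [smul_lie, lie_smul, hg.adj hij, smul_neg, smul_smul]
    congr 2
    linear_combination
      ε j * ε (j + 1) * (ε (i + 1) * ε (i + 1) * hε i + hε (i + 1))
  · simp only [smul_lie, lie_smul, hg.comm' hij, smul_zero]

end IsDolanGrady
end

/-! ### The braid relation in the triangle -/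

section BraidRelation

variable {L : Type*} [LieRing L] [LieAlgebra ℂ L]

omit [LieAlgebra ℂ L] in
theorem lie_lie_self_of_adj {a b : L} (h : ⁅b, ⁅b, a⁆⁆ = -a) : ⁅⁅b, a⁆, b⁆ = a := by
  rw [← lie_skew, h, neg_neg]

/-- The case of `T_braid` where a generator is adjacent to both reflections. The relation `hab`,
read as an identity between products of `ad a` and `ad b`, is evaluated at `⁅b, g⁆`, and also at `g`
followed by `ad b`; half the difference is the claim. -/
theorem braid_of_adj_adj {a b g : L} (hab : ⁅a, ⁅a, b⁆⁆ = -b) (hba : ⁅b, ⁅b, a⁆⁆ = -a)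
    (ha : ⁅a, ⁅a, g⁆⁆ = -g) (hb : ⁅b, ⁅b, g⁆⁆ = -g) :
    ⁅b, ⁅⁅a, b⁆, ⁅a, g⁆⁆⁆ = ⁅a, ⁅⁅b, a⁆, ⁅b, g⁆⁆⁆ := by
  obtain ⟨A, hA⟩ : ∃ A : L →ₗ[ℂ] L, ∀ x, ⁅a, x⁆ = A x := ⟨LieAlgebra.ad ℂ L a, fun _ => rfl⟩
  obtain ⟨B, hB⟩ : ∃ B : L →ₗ[ℂ] L, ∀ x, ⁅b, x⁆ = B x := ⟨LieAlgebra.ad ℂ L b, fun _ => rfl⟩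
  have h1 : ∀ x, A (A (B x)) - (2 : ℂ) • A (B (A x)) + B (A (A x)) = -B x := fun x => by
    have h := congrArg (fun y => ⁅y, x⁆) hab
    simp only [lie_lie, neg_lie, lie_sub] at h
    simp only [hA, hB] at h
    linear_combination (norm := module) h
  have h2 : ∀ x, B (B (A x)) - (2 : ℂ) • B (A (B x)) + A (B (B x)) = -A x := fun x => by
    have h := congrArg (fun y => ⁅y, x⁆) hba
    simp only [lie_lie, neg_lie, lie_sub] at h
    simp only [hA, hB] at h
    linear_combination (norm := module) h
  simp only [lie_lie, lie_sub]
  simp only [hA, hB] at ha hb ⊢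
  have e1 := h1 (B g)
  have e2 := congrArg B (h1 g)
  simp only [map_sub, map_add, map_smul, map_neg, ha, hb] at e1 e2 ⊢
  linear_combination (norm := module) (1 / 2 : ℂ) • e1 - (1 / 2 : ℂ) • e2

end BraidRelation

/-! ### Braid group action on the presented algebra -/

/-- A Lie algebra generated by Dolan–Grady elements, with enough endomorphisms. -/
structure Presentation (N : ℕ) (A : Type*) [LieRing A] [LieAlgebra ℂ A] where
  three_le : 3 ≤ N
  gen : ZMod N → A
  rel : IsDolanGrady gen
  lift : ∀ g : ZMod N → A, IsDolanGrady g → ∃ φ : A →ₗ⁅ℂ⁆ A, ∀ i, φ (gen i) = g i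
  generates : ∀ K : LieSubalgebra ℂ A, (∀ i, gen i ∈ K) → K = ⊤

theorem natCast_ne_zero {N k : ℕ} (h0 : 0 < k) (h : k < N) : (k : ZMod N) ≠ 0 := fun h' =>
  absurd (Nat.le_of_dvd h0 ((ZMod.natCast_eq_zero_iff k N).1 h')) (by omega)

namespace Presentation

variable {N : ℕ} {A : Type*} [LieRing A] [LieAlgebra ℂ A] (P : Presentation N A)

include P in
theorem one_ne : (1 : ZMod N) ≠ 0 := by
  simpa using natCast_ne_zero (k := 1) one_pos (by have := P.three_le; omega)

include P in
theorem two_ne : (2 : ZMod N) ≠ 0 := by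
  simpa using natCast_ne_zero (k := 2) two_pos (by have := P.three_le; omega)

theorem hom_ext {φ ψ : A →ₗ⁅ℂ⁆ A} (h : ∀ i, φ (P.gen i) = ψ (P.gen i)) : φ = ψ := by
  let K : LieSubalgebra ℂ A :=
    { LinearMap.eqLocus (φ : A →ₗ[ℂ] A) (ψ : A →ₗ[ℂ] A) with
      lie_mem' := fun {x y} (hx : φ x = ψ x) (hy : φ y = ψ y) => by
        change φ ⁅x, y⁆ = ψ ⁅x, y⁆
        rw [LieHom.map_lie, LieHom.map_lie, hx, hy] }
  have hK : K = ⊤ := P.generates K h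
  ext x
  have hx : x ∈ K := by rw [hK]; trivial
  exact hx

include P in
theorem ne_succ (l : ZMod N) : l ≠ l + 1 := fun h => P.one_ne (by linear_combination -h)

/-- The automorphism `exp (π / 2 • ad (gen l))`. -/
noncomputable def T (l : ZMod N) : A →ₗ⁅ℂ⁆ A :=
  (P.lift _ (P.rel.twist P.one_ne l)).choose

theorem T_gen (l m : ZMod N) : P.T l (P.gen m) = twist P.gen l m :=
  (P.lift _ (P.rel.twist P.one_ne l)).choose_spec m

theorem T_gen_self (l : ZMod N) : P.T l (P.gen l) = P.gen l := by
  rw [T_gen, twist_of_not_adj (by simpa using P.ne_succ l)]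

theorem T_gen_succ (l : ZMod N) : P.T l (P.gen (l + 1)) = ⁅P.gen l, P.gen (l + 1)⁆ := by
  rw [T_gen, twist_adj (by simp)]

theorem T_succ_gen (l : ZMod N) : P.T (l + 1) (P.gen l) = ⁅P.gen (l + 1), P.gen l⁆ := by
  rw [T_gen, twist_adj (by simp)]

theorem T_gen_of_not_adj {l m : ZMod N} (h1 : m ≠ l + 1) (h2 : l ≠ m + 1) :
    P.T l (P.gen m) = P.gen m := by
  rw [T_gen, twist_of_not_adj (by tauto)]

theorem T_T_succ_gen (l : ZMod N) : P.T l (P.T (l + 1) (P.gen l)) = P.gen (l + 1) := by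
  rw [T_succ_gen, LieHom.map_lie, T_gen_self, T_gen_succ, lie_lie_self_of_adj (P.rel.succ l)]

theorem T_succ_T_gen (l : ZMod N) : P.T (l + 1) (P.T l (P.gen (l + 1))) = P.gen l := by
  rw [T_gen_succ, LieHom.map_lie, T_gen_self, T_succ_gen, lie_lie_self_of_adj (P.rel.pred l)]

/-- Homomorphisms are compared on generators. Both sides exchange `gen l` and `gen (l + 1)`. A
generator adjacent to just one of the two is sent by both sides to the same double bracket, up to
the Jacobi identity; adjacency to both is `braid_of_adj_adj`. -/
theorem T_braid (l : ZMod N) (x : A) :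
    P.T l (P.T (l + 1) (P.T l x)) = P.T (l + 1) (P.T l (P.T (l + 1) x)) := by
  have h1 := P.one_ne
  have h2 := P.two_ne
  have key : ((P.T l).comp (P.T (l + 1))).comp (P.T l)
      = ((P.T (l + 1)).comp (P.T l)).comp (P.T (l + 1)) := by
    refine P.hom_ext fun m => ?_
    simp only [LieHom.comp_apply]
    by_cases hml : m = l
    · subst hml
      rw [T_gen_self, T_T_succ_gen, T_gen_self]
    by_cases hml1 : m = l + 1
    · subst hml1
      rw [T_gen_self, T_succ_T_gen, T_gen_self]
    have e1 := P.T_T_succ_gen l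
    have e2 := P.T_succ_T_gen l
    by_cases hl : l = m + 1 <;> by_cases hr : m = l + 1 + 1
    · have a1 : P.T l (P.gen m) = ⁅P.gen l, P.gen m⁆ := by rw [T_gen, twist_adj (Or.inr hl)]
      have a2 : P.T (l + 1) (P.gen m) = ⁅P.gen (l + 1), P.gen m⁆ := by
        rw [T_gen, twist_adj (Or.inl hr)]
      rw [a1, a2]
      simp only [LieHom.map_lie, e1, e2]
      rw [a1, a2]
      simp only [LieHom.map_lie, a1, a2, T_succ_gen, T_gen_succ]
      exact braid_of_adj_adj (P.rel.succ l) (P.rel.pred l) (P.rel.adj (Or.inr hl))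
        (P.rel.adj (Or.inl hr))
    · have a1 : P.T l (P.gen m) = ⁅P.gen l, P.gen m⁆ := by rw [T_gen, twist_adj (Or.inr hl)]
      have a2 : P.T (l + 1) (P.gen m) = P.gen m := P.T_gen_of_not_adj hr (by grind)
      have hc : ⁅P.gen (l + 1), P.gen m⁆ = 0 := P.rel.comm _ _ hr (by grind)
      rw [T_succ_gen] at e1
      rw [a2, a1, LieHom.map_lie (P.T (l + 1)), a2, T_succ_gen, LieHom.map_lie, e1, a1,
        lie_lie, hc, lie_zero, sub_zero]
    · have a1 : P.T l (P.gen m) = P.gen m := P.T_gen_of_not_adj hml1 hl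
      have a2 : P.T (l + 1) (P.gen m) = ⁅P.gen (l + 1), P.gen m⁆ := by
        rw [T_gen, twist_adj (Or.inl hr)]
      have hc : ⁅P.gen l, P.gen m⁆ = 0 := P.rel.comm _ _ hml1 hl
      rw [T_gen_succ] at e2
      rw [a1, a2, LieHom.map_lie (P.T l), a1, T_gen_succ, LieHom.map_lie, e2, a2,
        lie_lie, hc, lie_zero, sub_zero]
    · have a1 : P.T l (P.gen m) = P.gen m := P.T_gen_of_not_adj hml1 hl
      have a2 : P.T (l + 1) (P.gen m) = P.gen m := P.T_gen_of_not_adj hr (by grind)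
      simp only [a1, a2]
  exact congrArg (fun φ : A →ₗ⁅ℂ⁆ A => φ x) key

theorem T_comm {l m : ZMod N} (h1 : m ≠ l + 1) (h2 : l ≠ m + 1) (x : A) :
    P.T l (P.T m x) = P.T m (P.T l x) := by
  have key : (P.T l).comp (P.T m) = (P.T m).comp (P.T l) := by
    refine P.hom_ext fun k => ?_
    simp only [LieHom.comp_apply]
    have a1 := P.T_gen_of_not_adj h1 h2
    have a2 := P.T_gen_of_not_adj h2 h1
    have hc : ⁅P.gen l, P.gen m⁆ = 0 := P.rel.comm l m h1 h2
    by_cases hl : k = l + 1 ∨ l = k + 1 <;> by_cases hm : k = m + 1 ∨ m = k + 1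
    · have b1 : P.T l (P.gen k) = ⁅P.gen l, P.gen k⁆ := by rw [T_gen, twist_adj hl]
      have b2 : P.T m (P.gen k) = ⁅P.gen m, P.gen k⁆ := by rw [T_gen, twist_adj hm]
      rw [b1, b2]
      simp only [LieHom.map_lie, a1, a2, b1, b2]
      rw [leibniz_lie (P.gen l), hc, zero_lie, zero_add]
    · have b1 : P.T l (P.gen k) = ⁅P.gen l, P.gen k⁆ := by rw [T_gen, twist_adj hl]
      have b2 : P.T m (P.gen k) = P.gen k := by rw [T_gen, twist_of_not_adj hm]
      rw [b1, b2]
      simp only [LieHom.map_lie, a2, b1, b2]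
    · have b1 : P.T l (P.gen k) = P.gen k := by rw [T_gen, twist_of_not_adj hl]
      have b2 : P.T m (P.gen k) = ⁅P.gen m, P.gen k⁆ := by rw [T_gen, twist_adj hm]
      rw [b1, b2]
      simp only [LieHom.map_lie, a1, b1]
    · have b1 : P.T l (P.gen k) = P.gen k := by rw [T_gen, twist_of_not_adj hl]
      have b2 : P.T m (P.gen k) = P.gen k := by rw [T_gen, twist_of_not_adj hm]
      simp only [b1, b2]
  exact congrArg (fun φ : A →ₗ⁅ℂ⁆ A => φ x) key

/-- The sign automorphism `gen m ↦ ε m * ε (m + 1) • gen m`. -/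
theorem exists_sign {ε : ZMod N → ℂ} (hε : ∀ m, ε m * ε m = 1) :
    ∃ φ : A →ₗ⁅ℂ⁆ A, ∀ m, φ (P.gen m) = (ε m * ε (m + 1)) • P.gen m :=
  P.lift _ (P.rel.smul_sign hε)

end Presentation

/-! ### Affine permutations of the integers and their signs -/

section AffinePermutations

variable {N : ℕ}

/-- The affine simple reflection that exchanges the integers congruent to `l` with their
successors. -/
def swap (l : ZMod N) (x : ℤ) : ℤ :=
  if (x : ZMod N) = l then x + 1 else if (x : ZMod N) = l + 1 then x - 1 else x

/-- The sign attached to `swap`. -/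
noncomputable def sg (l : ZMod N) (x : ℤ) : ℂ :=
  if (x : ZMod N) = l then -1 else 1

theorem sg_mul_self (l : ZMod N) (x : ℤ) : sg l x * sg l x = 1 := by
  unfold sg; split_ifs <;> norm_num

theorem swap_of_eq {l : ZMod N} {x : ℤ} (h : (x : ZMod N) = l) : swap l x = x + 1 := if_pos h

theorem swap_of_eq_succ (h1 : (1 : ZMod N) ≠ 0) {l : ZMod N} {x : ℤ} (h : (x : ZMod N) = l + 1) :
    swap l x = x - 1 := by
  rw [swap, if_neg, if_pos h]
  rw [h]
  simpa using h1

theorem swap_of_ne {l : ZMod N} {x : ℤ} (h : (x : ZMod N) ≠ l) (h' : (x : ZMod N) ≠ l + 1) :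
    swap l x = x := by
  rw [swap, if_neg h, if_neg h']

theorem sg_of_eq {l : ZMod N} {x : ℤ} (h : (x : ZMod N) = l) : sg l x = -1 := if_pos h

theorem sg_of_ne {l : ZMod N} {x : ℤ} (h : (x : ZMod N) ≠ l) : sg l x = 1 := if_neg h

theorem swap_swap (h1 : (1 : ZMod N) ≠ 0) (l : ZMod N) (x : ℤ) : swap l (swap l x) = x := by
  by_cases hl : (x : ZMod N) = l
  · rw [swap_of_eq hl, swap_of_eq_succ h1 (by push_cast; rw [hl]), add_sub_cancel_right]
  by_cases hr : (x : ZMod N) = l + 1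
  · rw [swap_of_eq_succ h1 hr, swap_of_eq (by push_cast; rw [hr, add_sub_cancel_right]),
      sub_add_cancel]
  · rw [swap_of_ne hl hr, swap_of_ne hl hr]

theorem cast_swap (l : ZMod N) (x : ℤ) : (swap l x : ZMod N) =
    if (x : ZMod N) = l then l + 1 else if (x : ZMod N) = l + 1 then l else x := by
  unfold swap
  split_ifs with h h' <;> simp_all

theorem cast_swap_inj (h1 : (1 : ZMod N) ≠ 0) {l : ZMod N} {x y : ℤ} :
    (swap l x : ZMod N) = swap l y ↔ (x : ZMod N) = y := by
  have : ∀ l : ZMod N, l ≠ l + 1 := fun l => by simpa using h1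
  rw [cast_swap, cast_swap]
  split_ifs <;> grind

theorem swap_lt_swap (h1 : (1 : ZMod N) ≠ 0) {l : ZMod N} {x y : ℤ} (h : x < y)
    (h' : ¬((x : ZMod N) = l ∧ y = x + 1)) : swap l x < swap l y := by
  rcases eq_or_ne y (x + 1) with rfl | hy
  · have hx : (x : ZMod N) ≠ l := fun hx => h' ⟨hx, rfl⟩
    have hx' : ((x + 1 : ℤ) : ZMod N) ≠ l + 1 := by
      push_cast
      exact fun h => hx (add_right_cancel h)
    unfold swap
    split_ifs <;> first | omega | tauto
  rcases eq_or_ne y (x + 2) with rfl | hy2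
  · have : ¬((x : ZMod N) = l ∧ ((x + 2 : ℤ) : ZMod N) = l + 1) := by
      rintro ⟨hx, hx'⟩
      push_cast at hx'
      exact h1 (by linear_combination hx' - hx)
    unfold swap
    split_ifs <;> first | omega | tauto
  · unfold swap
    split_ifs <;> omega

theorem swap_comm {l m : ZMod N} (h0 : m ≠ l) (h1 : m ≠ l + 1) (h2 : l ≠ m + 1) (x : ℤ) :
    swap l (swap m x) = swap m (swap l x) := by
  by_cases a : (x : ZMod N) = l <;> by_cases b : (x : ZMod N) = l + 1 <;>
    by_cases c : (x : ZMod N) = m <;> by_cases d : (x : ZMod N) = m + 1 <;>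
    simp only [swap, a, b, c, d, if_true, if_false] <;> push_cast <;> grind

theorem sg_swap_of_ne {l m : ZMod N} (h0 : m ≠ l) (h2 : l ≠ m + 1) (x : ℤ) :
    sg l (swap m x) = sg l x := by
  unfold sg swap
  split_ifs <;> grind

/-- Consistency of the signs with `T_braid`: the signs picked up by one index along the two reduced
words agree. -/
theorem swap_braid_and_sg_braid (h1 : (1 : ZMod N) ≠ 0) (h2 : (2 : ZMod N) ≠ 0) (l : ZMod N)
    (x : ℤ) : swap l (swap (l + 1) (swap l x)) = swap (l + 1) (swap l (swap (l + 1) x)) ∧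
    sg l x * sg (l + 1) (swap l x) * sg l (swap (l + 1) (swap l x)) =
      sg (l + 1) x * sg l (swap (l + 1) x) * sg (l + 1) (swap l (swap (l + 1) x)) := by
  have e1 : ∀ m : ZMod N, m + 1 ≠ m := fun m => by simpa using h1
  have e2 : ∀ m : ZMod N, m ≠ m + 1 := fun m => by simpa using h1
  have e3 : ∀ m : ZMod N, m ≠ m + 1 + 1 := fun m h => h2 (by linear_combination -h)
  have e4 : ∀ m : ZMod N, m + 1 + 1 ≠ m := fun m h => h2 (by linear_combination h)
  by_cases a : (x : ZMod N) = l
  · simp [swap, sg, a, e1, e2, e3, e4]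
  by_cases b : (x : ZMod N) = l + 1
  · simp [swap, sg, b, e1, e2, e3, e4]
  by_cases c : (x : ZMod N) = l + 1 + 1
  · simp [swap, sg, c, e1, e2, e3, e4]
  · simp [swap, sg, a, b, c]

end AffinePermutations
-- Real root vectors and the action of the reflections
namespace Presentation

variable {N : ℕ} {A : Type*} [LieRing A] [LieAlgebra ℂ A] (P : Presentation N A)

/-- The real root vector attached to the pair of integers `i < i + w`. -/
noncomputable def rootAux : ℕ → ℤ → A
  | 0, _ => 0
  | 1, i => P.gen i
  | w + 2, i =>
    if ((w + 1 : ℕ) : ZMod N) = 0 then -P.T i (rootAux w (i + 1))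
    else P.T i (rootAux (w + 1) (i + 1))

/-- The real root vectors, antisymmetric in the two indices; in the loop algebra they are
`E_{ij} - E_{ji}` for a suitable normalisation of the periodic matrix units. Only used for `i` and
`j` distinct modulo `N`. -/
noncomputable def root (i j : ℤ) : A :=
  if i < j then P.rootAux (j - i).toNat i else -P.rootAux (i - j).toNat j

theorem root_antisymm (i j : ℤ) : P.root i j = -P.root j i := by
  rcases lt_trichotomy i j with h | rfl | h
  · rw [root, root, if_pos h, if_neg h.not_gt, neg_neg]
  · simp [root, rootAux]
  · rw [root, root, if_pos h, if_neg h.not_gt]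

theorem root_succ (i : ℤ) : P.root i (i + 1) = P.gen i := by
  simp [root, rootAux]

theorem rootAux_shift (w : ℕ) (i : ℤ) : P.rootAux w (i + N) = P.rootAux w i := by
  induction w using Nat.strong_induction_on generalizing i with
  | _ w ih =>
    match w with
    | 0 => rfl
    | 1 => simp [rootAux]
    | w + 2 =>
      rw [rootAux, rootAux, add_right_comm, ih w (by omega), ih (w + 1) (by omega)]
      simp

theorem root_shift (i j : ℤ) : P.root (i + N) (j + N) = P.root i j := by
  simp only [root, add_lt_add_iff_right, add_sub_add_right_eq_sub, rootAux_shift]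

theorem root_add_mul (i j n : ℤ) : P.root (i + n * N) (j + n * N) = P.root i j := by
  induction n using Int.induction_on with
  | zero => simp
  | succ k ih => rw [← ih, ← P.root_shift (i + k * N)]; congr 1 <;> ring
  | pred k ih => rw [← ih, ← P.root_shift (i + (-k - 1) * N)]; congr 1 <;> ring

include P in
theorem swap_lt {l : ZMod N} {x y : ℤ} (h : x < y)
    (h' : ¬((x : ZMod N) = l ∧ y = x + 1)) : swap l x < swap l y :=
  swap_lt_swap P.one_ne h h'

/-- This unfolds the recursion of `rootAux`. Its exceptional branch is the case `j ≡ i`: the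
reflection then moves both ends apart, the width grows by two, and a sign appears. -/
theorem T_root_raise' {i j : ℤ} (hij : i + 1 < j) (hne : ((i + 1 : ℤ) : ZMod N) ≠ j) :
    P.T i (P.root (i + 1) j) = sg (i : ZMod N) j • P.root i (swap (i : ZMod N) j) := by
  have hw : ∃ w : ℕ, j = i + 1 + (w + 1) := ⟨(j - (i + 2)).toNat, by omega⟩
  obtain ⟨w, rfl⟩ := hw
  have hne' : ((w + 1 : ℕ) : ZMod N) ≠ 0 := by
    intro h
    push_cast at h hne
    exact hne (by linear_combination -h)
  by_cases h : ((i + 1 + (w + 1) : ℤ) : ZMod N) = i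
  · rw [sg_of_eq h, swap_of_eq h, root, root, if_pos (by omega), if_pos (by omega),
      show (i + 1 + (w + 1) - (i + 1)).toNat = w + 1 by omega,
      show (i + 1 + (w + 1) + 1 - i).toNat = w + 1 + 2 by omega, rootAux, if_pos, neg_one_smul,
      neg_neg]
    push_cast at h ⊢
    linear_combination h
  · rw [sg_of_ne h, swap_of_ne h, root, root, if_pos (by omega), if_pos (by omega),
      show (i + 1 + (w + 1) - (i + 1)).toNat = w + 1 by omega,
      show (i + 1 + (w + 1) - i).toNat = w + 2 by omega, rootAux, if_neg hne', one_smul]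
    · push_cast
      push_cast at hne
      exact fun h' => hne h'.symm

theorem T_root_raise {i j : ℤ} (hij : i < j) (hne : (i : ZMod N) ≠ j) {l : ZMod N}
    (hl : (i : ZMod N) = l + 1) : P.T l (P.root i j) = sg l j • P.root (i - 1) (swap l j) := by
  have hl' : l = ((i - 1 : ℤ) : ZMod N) := by push_cast; rw [hl, add_sub_cancel_right]
  have := P.T_root_raise' (i := i - 1) (j := j) (by omega) (by simpa using hne)
  rwa [sub_add_cancel, ← hl'] at this

/-- Every positive real root vector that is not a generator comes from one of smaller width. -/
theorem exists_lower {i j : ℤ} (hij : i < j) (hne : (i : ZMod N) ≠ j) (hj : j ≠ i + 1) :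
    ∃ j', swap (i : ZMod N) j' = j ∧ i + 1 < j' ∧ ((i + 1 : ℤ) : ZMod N) ≠ j' ∧ j' ≤ j ∧
      P.root i j = sg (i : ZMod N) j' • P.T i (P.root (i + 1) j') := by
  have h1 := P.one_ne
  have e : swap (i : ZMod N) i = i + 1 := swap_of_eq rfl
  have hne' : ((i + 1 : ℤ) : ZMod N) ≠ swap (i : ZMod N) j := by
    rw [← e]; exact fun h => hne ((cast_swap_inj h1).1 h)
  have hlt : i + 1 < swap (i : ZMod N) j := by
    rw [← e]; exact P.swap_lt hij (fun h => hj h.2)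
  refine ⟨swap (i : ZMod N) j, swap_swap h1 _ _, hlt, hne', ?_, ?_⟩
  · unfold swap
    split_ifs with h
    · exact absurd h.symm hne
    all_goals omega
  · rw [T_root_raise' P hlt hne', swap_swap h1, smul_smul, sg_mul_self, one_smul]

/-- Moving a sign automorphism past `T l` permutes `ε` by the transposition of `l` and `l + 1`. -/
theorem sign_T {ε : ZMod N → ℂ} (hε : ∀ m, ε m * ε m = 1) {φ ψ : A →ₗ⁅ℂ⁆ A}
    (hφ : ∀ m, φ (P.gen m) = (ε m * ε (m + 1)) • P.gen m) (l : ZMod N)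
    (hψ : ∀ m, ψ (P.gen m) = (ε (Equiv.swap l (l + 1) m) * ε (Equiv.swap l (l + 1) (m + 1))) •
      P.gen m) (x : A) : φ (P.T l x) = P.T l (ψ x) := by
  have h2 := P.two_ne
  have e2 := P.ne_succ
  have key : φ.comp (P.T l) = (P.T l).comp ψ := by
    refine P.hom_ext fun m => ?_
    rw [LieHom.comp_apply, LieHom.comp_apply, hψ, map_smul, T_gen]
    by_cases h : m = l + 1
    · subst h
      rw [twist_adj (Or.inl rfl), LieHom.map_lie, hφ, hφ, smul_lie, lie_smul, smul_smul,
        Equiv.swap_apply_right, Equiv.swap_apply_of_ne_of_ne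
          (fun h => h2 (by linear_combination h)) (e2 _).symm]
      congr 1
      linear_combination ε l * ε (l + 1 + 1) * hε (l + 1)
    by_cases h' : l = m + 1
    · subst h'
      rw [twist_adj (Or.inr rfl), LieHom.map_lie, hφ, hφ, smul_lie, lie_smul, smul_smul,
        Equiv.swap_apply_left, Equiv.swap_apply_of_ne_of_ne (e2 _)
          (fun h => h2 (by linear_combination -h))]
      congr 1
      linear_combination ε m * ε (m + 1 + 1) * hε (m + 1)
    rw [twist_of_not_adj (by tauto), hφ]
    by_cases hl : m = l
    · subst hl
      rw [Equiv.swap_apply_left, Equiv.swap_apply_right, mul_comm]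
    · rw [Equiv.swap_apply_of_ne_of_ne hl h, Equiv.swap_apply_of_ne_of_ne (Ne.symm h')
        (fun h => hl (add_right_cancel h))]
  exact congrArg (fun φ : A →ₗ⁅ℂ⁆ A => φ x) key

/-- Induction on the width by `exists_lower`. The signs must vary in the induction, since `sign_T`
replaces `ε` by a permuted family. -/
theorem sign_root (n : ℕ) : ∀ {ε : ZMod N → ℂ}, (∀ m, ε m * ε m = 1) → ∀ {φ : A →ₗ⁅ℂ⁆ A},
    (∀ m, φ (P.gen m) = (ε m * ε (m + 1)) • P.gen m) → ∀ {i j : ℤ}, i < j → (i : ZMod N) ≠ j →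
    j ≤ i + n → φ (P.root i j) = (ε i * ε j) • P.root i j := by
  induction n with
  | zero => intro _ _ _ _ i j h1 _ h2; push_cast at h2; omega
  | succ n ih =>
    intro ε hε φ hφ i j hij hne hjn
    by_cases hj : j = i + 1
    · subst hj
      rw [root_succ, hφ]
      push_cast
      rfl
    · obtain ⟨j', rfl, hlt, hne', hle, hR⟩ := P.exists_lower hij hne hj
      have hε' : ∀ m, ε (Equiv.swap (i : ZMod N) (i + 1) m) *
        ε (Equiv.swap (i : ZMod N) (i + 1) m) = 1 := fun m => hε _
      obtain ⟨ψ, hψ⟩ := P.exists_sign hε'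
      rw [hR, map_smul, P.sign_T hε hφ _ hψ, ih hε' hψ hlt hne' (by push_cast at hjn ⊢; omega),
        map_smul, smul_comm]
      congr 3
      · push_cast
        rw [Equiv.swap_apply_right]
      · rw [cast_swap, Equiv.swap_apply_def]

/-- A half turn is a sign automorphism: `T l` squared negates exactly the neighbours of `l`, which
corresponds to `ε = -1` at `l` and `l + 1`. So `sign_root` applies. -/
theorem T_T_root {i j : ℤ} (hij : i < j) (hne : (i : ZMod N) ≠ j) (l : ZMod N) :
    P.T l (P.T l (P.root i j)) =
      (sg l i * sg l (swap l i) * (sg l j * sg l (swap l j))) • P.root i j := by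
  have h1 := P.one_ne
  have h2 := P.two_ne
  let ε : ZMod N → ℂ := fun m => if m = l ∨ m = l + 1 then -1 else 1
  have hε : ∀ m, ε m * ε m = 1 := fun m => by simp only [ε]; split_ifs <;> norm_num
  have hs : ∀ x : ℤ, sg l x * sg l (swap l x) = ε x := fun x => by
    simp only [sg, cast_swap, ε]
    have := P.ne_succ l
    split_ifs <;> grind
  rw [hs, hs]
  refine P.sign_root (φ := (P.T l).comp (P.T l)) (j - i).toNat hε (fun m => ?_) hij hne (by omega)
  rw [LieHom.comp_apply]
  have e1 : ∀ m : ZMod N, m + 1 ≠ m := fun m => by simpa using h1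
  have e2 : ∀ m : ZMod N, m ≠ m + 1 := fun m => by simpa using h1
  have e3 : ∀ m : ZMod N, m ≠ m + 1 + 1 := fun m h => h2 (by linear_combination -h)
  have e4 : ∀ m : ZMod N, m + 1 + 1 ≠ m := fun m h => h2 (by linear_combination h)
  by_cases hm : m = l + 1
  · subst hm
    rw [T_gen_succ, LieHom.map_lie, T_gen_self, T_gen_succ, P.rel.succ]
    simp [ε, e4, h1]
  by_cases hm' : l = m + 1
  · subst hm'
    rw [T_succ_gen, LieHom.map_lie, T_gen_self, T_succ_gen, P.rel.pred]
    simp [ε, e3, h1]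
  · rw [T_gen_of_not_adj _ hm hm', T_gen_of_not_adj _ hm hm']
    simp only [ε, hm, Ne.symm hm', add_left_inj]
    split_ifs <;> simp_all

/-- Induction on the width, writing the root vector as `± T i` of a narrower one. How `T l`
interacts with `T i` depends on `l - i`: it undoes the definition, squares, braids or commutes. -/
theorem T_root_of_lt (n : ℕ) : ∀ (i j : ℤ), i < j → (i : ZMod N) ≠ j → j ≤ i + n → ∀ l : ZMod N,
    P.T l (P.root i j) = (sg l i * sg l j) • P.root (swap l i) (swap l j) := by
  have h1 := P.one_ne
  have h2 := P.two_ne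
  have e2 := P.ne_succ
  induction n with
  | zero => intro i j h1 _ h2; push_cast at h2; omega
  | succ n ih =>
    intro i j hij hne hjn l
    by_cases hj : j = i + 1
    · subst hj
      rw [root_succ]
      by_cases hl : l = (i : ZMod N)
      · subst hl
        rw [T_gen_self, sg_of_eq rfl, swap_of_eq rfl, swap_of_eq_succ h1 (by push_cast; rfl),
          root_antisymm, add_sub_cancel_right, root_succ,
          sg_of_ne (by push_cast; exact (e2 _).symm)]
        module
      by_cases hl2 : l = (i : ZMod N) + 1
      · subst hl2
        have := P.T_root_raise' (i := i) (j := i + 1 + 1) (by omega)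
          (by push_cast; exact e2 _)
        rw [root_succ, sg_of_ne (by push_cast; exact fun h => h2 (by linear_combination h)),
          swap_of_ne (by push_cast; exact fun h => h2 (by linear_combination h))
            (by push_cast; exact (e2 _).symm), one_smul] at this
        rw [swap_of_ne (by exact e2 _) (by exact fun h => h2 (by linear_combination -h)),
          swap_of_eq (by push_cast; rfl), sg_of_ne (by exact e2 _), sg_of_eq (by push_cast; rfl),
          ← this, T_succ_gen]
        push_cast
        rw [T_gen_succ, ← lie_skew]
        module
      by_cases hl3 : (i : ZMod N) = l + 1
      · rw [← root_succ, T_root_raise P (by omega) hne hl3, sg_of_ne (x := i) (Ne.symm hl),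
          one_mul, swap_of_eq_succ h1 hl3]
      · rw [T_gen_of_not_adj _ hl3 hl2, sg_of_ne (Ne.symm hl),
          sg_of_ne (by push_cast; exact Ne.symm hl2), swap_of_ne (Ne.symm hl) hl3,
          swap_of_ne (by push_cast; exact Ne.symm hl2)
            (by push_cast; exact fun h => hl (add_right_cancel h).symm), root_succ]
        simp
    · obtain ⟨j', rfl, hlt, hne', hle, hR⟩ := P.exists_lower hij hne hj
      by_cases hl3 : (i : ZMod N) = l + 1
      · rw [T_root_raise P hij hne hl3, swap_of_eq_succ h1 hl3, sg_of_ne (x := i) (hl3 ▸ (e2 l).symm),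
          one_mul]
      by_cases hl : l = (i : ZMod N)
      · subst hl
        rw [hR, map_smul, T_T_root P hlt hne', swap_swap h1, smul_smul,
          sg_of_eq (x := i) rfl, swap_of_eq (x := i) rfl,
          swap_of_eq_succ h1 (x := i + 1) (by push_cast; rfl), add_sub_cancel_right,
          sg_of_eq (x := i) rfl, sg_of_ne (x := i + 1) (by push_cast; exact (e2 _).symm)]
        congr 1
        linear_combination -sg (i : ZMod N) (swap (i : ZMod N) j') * sg_mul_self (i : ZMod N) j'
      by_cases hl2 : l = (i : ZMod N) + 1
      · subst hl2
        by_cases hj' : j' = i + 1 + 1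
        · subst hj'
          have d1 : ((i + 1 + 1 : ℤ) : ZMod N) ≠ i := by
            push_cast; exact fun h => h2 (by linear_combination h)
          have d2 : ((i + 1 + 1 : ℤ) : ZMod N) ≠ (i : ZMod N) + 1 := by
            push_cast; exact (e2 _).symm
          have d3 : (i : ZMod N) ≠ i + 1 := e2 _
          have d4 : (i : ZMod N) ≠ i + 1 + 1 := fun h => h2 (by linear_combination -h)
          rw [hR, root_succ, map_smul, sg_of_ne d1, swap_of_ne d1 d2, sg_of_ne d2, sg_of_ne d3,
            swap_of_ne d3 d4, swap_of_eq_succ h1 (by push_cast; rfl), add_sub_cancel_right,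
            root_succ]
          push_cast
          rw [T_succ_T_gen]
          module
        -- Lowering twice produces `T (i + 1) (T i (T (i + 1) _))`. After the braid relation the
        -- inner `T i` is handled by induction, and the two outer maps only raise.
        obtain ⟨j'', rfl, hlt2, hne2, hle2, hR2⟩ := P.exists_lower hlt hne' hj'
        have d1 : ((i + 1 + 1 : ℤ) : ZMod N) ≠ i := by
          push_cast; exact fun h => h2 (by linear_combination h)
        have d2 : ((i + 1 + 1 : ℤ) : ZMod N) ≠ (i : ZMod N) + 1 := by
          push_cast; exact (e2 _).symm
        have d3 : (i : ZMod N) ≠ i + 1 := e2 _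
        have d4 : (i : ZMod N) ≠ i + 1 + 1 := fun h => h2 (by linear_combination -h)
        have c1 : ((i + 1 : ℤ) : ZMod N) = i + 1 := by push_cast; rfl
        have e : swap (i : ZMod N) (i + 1 + 1) = i + 1 + 1 := swap_of_ne d1 d2
        rw [c1] at hR hR2 hle hle2 hjn ⊢
        have hlt3 : i + 1 + 1 < swap (i : ZMod N) j'' := by
          conv_lhs => rw [← e]
          exact P.swap_lt hlt2 (fun h => d1 h.1)
        have hne3 : ((i + 1 + 1 : ℤ) : ZMod N) ≠ swap (i : ZMod N) j'' := by
          conv_lhs => rw [← e]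
          exact fun h => hne2 ((cast_swap_inj h1).1 h)
        have hlt4 : i + 1 < swap ((i : ZMod N) + 1) (swap (i : ZMod N) j'') := by
          have := P.swap_lt (l := (i : ZMod N) + 1) hlt3 (fun h => d2 h.1)
          rw [swap_of_eq_succ h1 (by push_cast; rfl)] at this
          omega
        have hne4 : ((i + 1 : ℤ) : ZMod N) ≠ swap ((i : ZMod N) + 1) (swap (i : ZMod N) j'') := by
          have : swap ((i : ZMod N) + 1) (i + 1 + 1) = i + 1 := by
            rw [swap_of_eq_succ h1 (by push_cast; rfl), add_sub_cancel_right]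
          rw [← this]
          exact fun h => hne3 ((cast_swap_inj h1).1 h)
        have hb := swap_braid_and_sg_braid h1 h2 (i : ZMod N) j''
        rw [hR, hR2, map_smul, map_smul, map_smul, ← T_braid,
          ih _ _ hlt2 hne2 (by push_cast at hjn ⊢; omega), e, map_smul,
          T_root_raise P hlt3 hne3 (by push_cast; rfl), map_smul, map_smul, add_sub_cancel_right,
          T_root_raise' P hlt4 hne4, hb.1, sg_of_ne d1, sg_of_ne d3, swap_of_ne d3 d4]
        simp only [smul_smul]
        congr 1
        linear_combination (sg (i : ZMod N) (swap ((i : ZMod N) + 1) j'') *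
          sg ((i : ZMod N) + 1) j'') * hb.2 +
          sg ((i : ZMod N) + 1) (swap (i : ZMod N) (swap ((i : ZMod N) + 1) j'')) *
          (sg ((i : ZMod N) + 1) j'' * sg ((i : ZMod N) + 1) j'' *
            sg_mul_self (i : ZMod N) (swap ((i : ZMod N) + 1) j'') +
            sg_mul_self ((i : ZMod N) + 1) j'')
      · have d1 : ((i + 1 : ℤ) : ZMod N) ≠ l := by push_cast; exact Ne.symm hl2
        have d2 : ((i + 1 : ℤ) : ZMod N) ≠ l + 1 := by
          push_cast; exact fun h => hl (add_right_cancel h).symm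
        have e : swap l (i + 1) = i + 1 := swap_of_ne d1 d2
        have hlt3 : i + 1 < swap l j' := by
          conv_lhs => rw [← e]
          exact P.swap_lt hlt (fun h => d1 h.1)
        have hne3 : ((i + 1 : ℤ) : ZMod N) ≠ swap l j' := by
          conv_lhs => rw [← e]
          exact fun h => hne' ((cast_swap_inj h1).1 h)
        rw [hR, map_smul, T_comm P hl3 hl2, ih (i + 1) j' hlt hne' (by push_cast at hjn ⊢; omega),
          e, map_smul, T_root_raise' P hlt3 hne3, sg_of_ne d1, sg_of_ne (Ne.symm hl),
          swap_of_ne (Ne.symm hl) hl3, swap_comm (Ne.symm hl) hl3 hl2,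
          sg_swap_of_ne (Ne.symm hl) hl2, sg_swap_of_ne hl hl3]
        simp only [smul_smul]
        congr 1
        linear_combination sg l j' * sg_mul_self (i : ZMod N) j'

theorem T_root {i j : ℤ} (hne : (i : ZMod N) ≠ j) (l : ZMod N) :
    P.T l (P.root i j) = (sg l i * sg l j) • P.root (swap l i) (swap l j) := by
  rcases lt_trichotomy i j with h | rfl | h
  · exact P.T_root_of_lt (j - i).toNat i j h hne (by omega) l
  · exact absurd rfl hne
  · rw [root_antisymm, map_neg, P.T_root_of_lt (i - j).toNat j i h hne.symm (by omega) l,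
      P.root_antisymm (swap l i), mul_comm, smul_neg]

end Presentation

/-! ### Brackets of real root vectors; imaginary root vectors -/

namespace Presentation

variable {N : ℕ} {A : Type*} [LieRing A] [LieAlgebra ℂ A] (P : Presentation N A)

/-- Apply `T l` to the reflected identity: the sign of the middle index occurs twice, so both sides
carry the same sign. -/
theorem lie_root_swap {x y z : ℤ} (hxy : (x : ZMod N) ≠ y) (hyz : (y : ZMod N) ≠ z)
    (hxz : (x : ZMod N) ≠ z) (l : ZMod N)
    (h : ⁅P.root (swap l x) (swap l y), P.root (swap l y) (swap l z)⁆ =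
      P.root (swap l x) (swap l z)) :
    ⁅P.root x y, P.root y z⁆ = P.root x z := by
  have h1 := P.one_ne
  have hne : ∀ {a b : ℤ}, (a : ZMod N) ≠ b → (swap l a : ZMod N) ≠ swap l b :=
    fun hab h => hab ((cast_swap_inj h1).1 h)
  have h' := congrArg (P.T l) h
  rw [LieHom.map_lie, T_root P (hne hxy), T_root P (hne hyz), T_root P (hne hxz), smul_lie,
    lie_smul, smul_smul] at h'
  simp only [swap_swap h1] at h'
  have hs := sg_mul_self l (swap l x)
  have hs2 := sg_mul_self l (swap l y)
  have hs3 := sg_mul_self l (swap l z)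
  rw [show sg l (swap l x) * sg l (swap l y) * (sg l (swap l y) * sg l (swap l z)) =
    sg l (swap l x) * sg l (swap l z) by
      linear_combination sg l (swap l x) * sg l (swap l z) * hs2] at h'
  refine smul_right_injective A (r := sg l (swap l x) * sg l (swap l z)) ?_ h'
  intro h0
  have : (sg l (swap l x) * sg l (swap l z)) * (sg l (swap l x) * sg l (swap l z)) = 1 := by
    linear_combination sg l (swap l z) * sg l (swap l z) * hs + hs3
  simp [h0] at this

/-- Induction on `z - x`: some reflection keeps the order and shrinks the triple, until `x, x + 1, x
+ 2` remains, where the Dolan–Grady relations give all three identities. -/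
theorem lie_root_sorted (n : ℕ) : ∀ {x y z : ℤ}, x < y → y < z → z ≤ x + n → (x : ZMod N) ≠ y →
    (y : ZMod N) ≠ z → (x : ZMod N) ≠ z →
    ⁅P.root x y, P.root y z⁆ = P.root x z ∧ ⁅P.root y x, P.root x z⁆ = P.root y z ∧
      ⁅P.root x z, P.root z y⁆ = P.root x y := by
  have h1 := P.one_ne
  have h2 := P.two_ne
  induction n with
  | zero => intro x y z _ _ h; push_cast at h; omega
  | succ n ih =>
    intro x y z hlt hlt' hn hxy hyz hxz
    have hne : ∀ (l : ZMod N) {a b : ℤ}, (a : ZMod N) ≠ b → (swap l a : ZMod N) ≠ swap l b :=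
      fun l a b hab h => hab ((cast_swap_inj h1).1 h)
    have key : ∀ l : ZMod N, swap l x < swap l y → swap l y < swap l z →
        swap l z - swap l x < z - x →
        ⁅P.root x y, P.root y z⁆ = P.root x z ∧ ⁅P.root y x, P.root x z⁆ = P.root y z ∧
        ⁅P.root x z, P.root z y⁆ = P.root x y := by
      intro l a b c
      obtain ⟨e1, e2, e3⟩ := ih a b (by push_cast at hn; omega) (hne l hxy) (hne l hyz) (hne l hxz)
      exact ⟨P.lie_root_swap hxy hyz hxz l e1, P.lie_root_swap hxy.symm hxz hyz l e2,
        P.lie_root_swap hxz hyz.symm hxy l e3⟩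
    by_cases hy : y = x + 1
    · by_cases hz : z = y + 1
      · subst hz hy
        have e : P.root x (x + 1 + 1) = ⁅P.gen x, P.gen (x + 1)⁆ := by
          have := P.T_root (i := x + 1) (j := x + 1 + 1) hyz x
          rw [root_succ, swap_of_eq_succ h1 (by push_cast; rfl), add_sub_cancel_right,
            swap_of_ne (Ne.symm hxz) (by push_cast; simpa using h1), sg_of_ne (Ne.symm hxy),
            sg_of_ne (Ne.symm hxz), mul_one, one_smul] at this
          push_cast at this
          rw [← this, T_gen_succ]
        rw [P.root_antisymm (x + 1) x, P.root_antisymm (x + 1 + 1) (x + 1), e, root_succ,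
          root_succ]
        push_cast
        refine ⟨rfl, ?_, ?_⟩
        · rw [neg_lie, P.rel.succ, neg_neg]
        · rw [lie_neg, ← lie_skew, ← lie_skew (P.gen _) (P.gen _), lie_neg, P.rel.pred]
          simp
      -- With no gap between `x` and `y`, pull `z` down; `x` cannot drop along with it because `x ≢
      -- z`.
      · refine key ((z - 1 : ℤ) : ZMod N) ?_ ?_ ?_
        · refine P.swap_lt hlt fun h => ?_
          subst hy
          refine hyz ?_
          have := h.1
          push_cast at this ⊢
          rw [this, sub_add_cancel]
        · refine P.swap_lt hlt' fun h => hz h.2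
        · rw [swap_of_eq_succ h1 (x := z) (by simp)]
          have : x ≤ swap ((z - 1 : ℤ) : ZMod N) x := by
            unfold swap
            split_ifs with a b
            · omega
            · exact absurd (by simpa using b) hxz
            · rfl
          omega
    -- With a gap after `x`, push `x` up; `z` cannot rise because `z ≢ x`.
    · refine key (x : ZMod N) ?_ ?_ ?_
      · exact P.swap_lt hlt fun h => hy h.2
      · exact P.swap_lt hlt' fun h => hxy h.1.symm
      · rw [swap_of_eq (x := x) rfl]
        have : swap (x : ZMod N) z ≤ z := by
          unfold swap
          split_ifs with a b
          · exact absurd a.symm hxz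
          · omega
          · rfl
        omega

/-- The root vectors multiply like the matrices `E_{xy} - E_{yx}`. -/
theorem lie_root {x y z : ℤ} (hxy : (x : ZMod N) ≠ y) (hyz : (y : ZMod N) ≠ z)
    (hxz : (x : ZMod N) ≠ z) : ⁅P.root x y, P.root y z⁆ = P.root x z := by
  have hrev : ∀ {x y z : ℤ}, ⁅P.root x y, P.root y z⁆ = P.root x z →
      ⁅P.root z y, P.root y x⁆ = P.root z x := by
    intro x y z h
    rw [P.root_antisymm z y, P.root_antisymm y x, P.root_antisymm z x, ← h, neg_lie, lie_neg,
      neg_neg, lie_skew]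
  have main : ∀ {x y z : ℤ}, x < y → y < z → (x : ZMod N) ≠ y →
    (y : ZMod N) ≠ z → (x : ZMod N) ≠ z →
    ⁅P.root x y, P.root y z⁆ = P.root x z ∧ ⁅P.root y x, P.root x z⁆ = P.root y z ∧
      ⁅P.root x z, P.root z y⁆ = P.root x y :=
    fun {x y z} a b => P.lie_root_sorted (z - x).toNat a b (by omega)
  have n1 : x ≠ y := fun h => hxy (by rw [h])
  have n2 : y ≠ z := fun h => hyz (by rw [h])
  have n3 : x ≠ z := fun h => hxz (by rw [h])
  rcases lt_or_gt_of_ne n1 with a | a <;> rcases lt_or_gt_of_ne n2 with b | b <;>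
    rcases lt_or_gt_of_ne n3 with c | c
  · exact (main a b hxy hyz hxz).1
  · omega
  · exact (main c b hxz hyz.symm hxy).2.2
  · exact hrev (main c a hxz.symm hxy hyz.symm).2.2
  · exact (main a c hxy.symm hxz hyz).2.1
  · exact hrev (main b c hyz hxz.symm hxy.symm).2.1
  · omega
  · exact hrev (main b a hyz.symm hxy.symm hxz.symm).1

/-- Factor `root c d` through `a` and expand by Leibniz. The resulting expression is symmetric under
exchanging `a` and `b`, whereas the bracket is antisymmetric. -/
theorem lie_root_of_disjoint {a b c d : ℤ} (hab : (a : ZMod N) ≠ b) (hac : (a : ZMod N) ≠ c)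
    (had : (a : ZMod N) ≠ d) (hbc : (b : ZMod N) ≠ c) (hbd : (b : ZMod N) ≠ d)
    (hcd : (c : ZMod N) ≠ d) : ⁅P.root a b, P.root c d⁆ = 0 := by
  have key : ∀ {a b c d : ℤ}, (a : ZMod N) ≠ b → (a : ZMod N) ≠ c → (a : ZMod N) ≠ d →
      (b : ZMod N) ≠ c → (b : ZMod N) ≠ d → (c : ZMod N) ≠ d →
      ⁅P.root a b, P.root c d⁆ = ⁅P.root a d, P.root c b⁆ + ⁅P.root a c, P.root b d⁆ := by
    intro a b c d hab hac had hbc hbd hcd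
    have e1 : P.root c d = ⁅P.root c a, P.root a d⁆ := (P.lie_root hac.symm had hcd).symm
    have e2 : ⁅P.root a b, P.root c a⁆ = -P.root c b := by
      rw [← lie_skew, P.lie_root hac.symm hab hbc.symm]
    have e3 : ⁅P.root a b, P.root a d⁆ = -P.root b d := by
      rw [P.root_antisymm a b, neg_lie, P.lie_root hab.symm had hbd]
    rw [e1, leibniz_lie, e2, e3, neg_lie, lie_skew, P.root_antisymm c a, neg_lie, lie_neg, neg_neg]
  have k1 := key hab hac had hbc hbd hcd
  have k2 := key hab.symm hbc hbd hac had hcd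
  rw [P.root_antisymm b a, neg_lie, P.root_antisymm c a, lie_neg] at k2
  rw [P.root_antisymm c b, lie_neg] at k1
  rw [← lie_skew (P.root b d), ← lie_skew (P.root b c)] at k2
  have : (2 : ℂ) • ⁅P.root a b, P.root c d⁆ = 0 := by
    linear_combination (norm := module) k1 - k2
  simpa using this

/-- The imaginary root vectors: `t^n • (E_{ii} - E_{jj})`, made invariant under the involution. -/
noncomputable def imag (n i j : ℤ) : A := ⁅P.root i j, P.root j (i + n * N)⁆

include P in
theorem exists_third (i j : ℤ) : ∃ k : ℤ, (i : ZMod N) ≠ k ∧ (j : ZMod N) ≠ k := by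
  have h1 := P.one_ne
  have h2 := P.two_ne
  by_cases h : (j : ZMod N) = i + 1
  · refine ⟨i + 2, ?_, ?_⟩ <;> push_cast <;> intro h'
    · exact h2 (by linear_combination -h')
    · exact h1 (by linear_combination h - h')
  · refine ⟨i + 1, ?_, ?_⟩ <;> push_cast
    · exact P.ne_succ _
    · exact h

theorem cast_add_mul (i n : ℤ) : ((i + n * N : ℤ) : ZMod N) = i := by
  push_cast
  simp

theorem imag_add (n : ℤ) {i j k : ℤ} (hij : (i : ZMod N) ≠ j) (hjk : (j : ZMod N) ≠ k)
    (hik : (i : ZMod N) ≠ k) : P.imag n i j + P.imag n j k = P.imag n i k := by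
  have e1 : ⁅P.root j k, P.root k (i + n * N)⁆ = P.root j (i + n * N) :=
    P.lie_root hjk (by rw [cast_add_mul]; exact hik.symm) (by rw [cast_add_mul]; exact hij.symm)
  have e2 : ⁅P.root i j, P.root k (i + n * N)⁆ = -P.root k (j + n * N) := by
    rw [← P.root_add_mul i j n, ← lie_skew, P.lie_root] <;> simp only [cast_add_mul]
    exacts [hik.symm, hij, hjk.symm]
  unfold imag
  rw [← P.lie_root hij hjk hik, lie_lie, e1, e2, lie_neg, sub_neg_eq_add]

theorem imag_antisymm (n : ℤ) {i j : ℤ} (hij : (i : ZMod N) ≠ j) :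
    P.imag n i j = -P.imag n j i := by
  obtain ⟨k, hik, hjk⟩ := P.exists_third i j
  have e1 := P.imag_add n hij hjk hik
  have e2 := P.imag_add n hij.symm hik hjk
  linear_combination (norm := module) e1 + e2

theorem imag_shift (n i j a : ℤ) : P.imag n (i + a * N) (j + a * N) = P.imag n i j := by
  unfold imag
  rw [root_add_mul, add_right_comm, root_add_mul]

theorem imag_zero (i j : ℤ) : P.imag 0 i j = 0 := by
  rw [imag, zero_mul, add_zero, P.root_antisymm j i, lie_neg, lie_self, neg_zero]

theorem imag_eq_neg_imag (n i j : ℤ) : P.imag n i j = -P.imag n j (i + n * N) := by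
  unfold imag
  rw [root_add_mul, lie_skew]

/-- By additivity, the effect of shifting the second index does not depend on the first. -/
theorem imag_diff (n : ℤ) {i j k : ℤ} (hij : (i : ZMod N) ≠ j) (hjk : (j : ZMod N) ≠ k)
    (hik : (i : ZMod N) ≠ k) : P.imag n i (j + N) - P.imag n i j =
      P.imag n k (j + N) - P.imag n k j := by
  have hj : ((j + N : ℤ) : ZMod N) = j := by push_cast; simp
  have e1 := P.imag_add n hik hjk.symm hij
  have e2 := P.imag_add n (j := k) (k := j + N) hik (by rw [hj]; exact hjk.symm)
    (by rw [hj]; exact hij)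
  linear_combination (norm := module) e1 - e2

/-- By `imag_diff` and simultaneous shifts, the value is an affine function of `a`; the point is
that its slope vanishes. -/
theorem imag_add_mul_right (n : ℤ) {i j : ℤ} (hij : (i : ZMod N) ≠ j) (a : ℤ) :
    P.imag n i (j + a * N) = P.imag n i j := by
  rcases eq_or_ne n 0 with rfl | hn
  · rw [imag_zero, imag_zero]
  have step : ∀ {i j : ℤ}, (i : ZMod N) ≠ j → ∀ a : ℤ, P.imag n i (j + a * N + N) -
      P.imag n i (j + a * N) = P.imag n i (j + N) - P.imag n i j := by
    intro i j hij a
    obtain ⟨k, hik, hjk⟩ := P.exists_third i j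
    rw [P.imag_diff n hij hjk hik, ← P.imag_diff n (i := i + -a * N) (by rw [cast_add_mul]; exact hij)
      hjk (by rw [cast_add_mul]; exact hik), ← P.imag_shift n (i + -a * N) j a,
      ← P.imag_shift n (i + -a * N) (j + N) a]
    congr 2 <;> ring_nf
  have lin : ∀ {i j : ℤ}, (i : ZMod N) ≠ j → ∀ a : ℤ, P.imag n i (j + a * N) =
      P.imag n i j + (a : ℂ) • (P.imag n i (j + N) - P.imag n i j) := by
    intro i j hij a
    induction a using Int.induction_on with
    | zero => simp
    | succ a ih =>
      have := step hij a
      rw [show j + (a + 1 : ℤ) * (N : ℤ) = j + a * N + N by ring]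
      push_cast
      linear_combination (norm := module) this + ih
    | pred a ih =>
      have := step hij (-a - 1)
      rw [show j + (-a - 1 : ℤ) * (N : ℤ) + N = j + -a * N by ring] at this
      push_cast at *
      linear_combination (norm := module) ih - this
  -- At `a = n` the bracket defining `imag` can be read backwards, which with antisymmetry returns
  -- the value at `a = 0`; hence `n` times the slope is zero.
  have hzero : P.imag n i (j + N) - P.imag n i j = 0 := by
    have e1 := lin hij n
    have e2 := P.imag_eq_neg_imag n j i
    rw [P.imag_antisymm n hij.symm] at e2
    have : (n : ℂ) • (P.imag n i (j + N) - P.imag n i j) = 0 := by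
      linear_combination (norm := module) e2 - e1
    exact (smul_eq_zero.1 this).resolve_left (by exact_mod_cast hn)
  rw [lin hij, hzero, smul_zero, add_zero]

theorem imag_add_mul_left (n : ℤ) {i j : ℤ} (hij : (i : ZMod N) ≠ j) (a : ℤ) :
    P.imag n (i + a * N) j = P.imag n i j := by
  rw [P.imag_antisymm n (by rw [cast_add_mul]; exact hij), P.imag_add_mul_right n hij.symm,
    ← P.imag_antisymm n hij]

theorem imag_neg (n : ℤ) {i j : ℤ} (hij : (i : ZMod N) ≠ j) :
    P.imag (-n) i j = -P.imag n i j := by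
  rw [← P.imag_add_mul_left (-n) hij n, imag, imag, show i + n * N + -n * N = i by ring,
    ← lie_skew, neg_inj, P.root_antisymm j i, P.root_antisymm (i + n * N) j, neg_lie, lie_neg,
    neg_neg]

end Presentation

/-! ### The root vectors span -/

namespace Presentation

variable {N : ℕ} {A : Type*} [LieRing A] [LieAlgebra ℂ A] (P : Presentation N A)

/-- The span of the real root vectors. -/
def rootSpan : Submodule ℂ A :=
  Submodule.span ℂ {x | ∃ i j : ℤ, (i : ZMod N) ≠ j ∧ x = P.root i j}

/-- The span of the real and the imaginary root vectors. -/
def fullSpan : Submodule ℂ A :=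
  P.rootSpan ⊔ Submodule.span ℂ {x | ∃ n i j : ℤ, (i : ZMod N) ≠ j ∧ x = P.imag n i j}

theorem root_mem {i j : ℤ} (h : (i : ZMod N) ≠ j) : P.root i j ∈ P.rootSpan :=
  Submodule.subset_span ⟨i, j, h, rfl⟩

theorem rootSpan_le : P.rootSpan ≤ P.fullSpan := le_sup_left

theorem imag_mem (n : ℤ) {i j : ℤ} (h : (i : ZMod N) ≠ j) : P.imag n i j ∈ P.fullSpan :=
  Submodule.mem_sup_right (Submodule.subset_span ⟨n, i, j, h, rfl⟩)

theorem exists_eq_add_mul {i j : ℤ} (h : (i : ZMod N) = j) : ∃ n : ℤ, j = i + n * N := by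
  obtain ⟨n, hn⟩ := (ZMod.intCast_eq_intCast_iff_dvd_sub i j N).1 h
  exact ⟨n, by linarith⟩

theorem lie_root_of_adjacent {a b c d : ℤ} (hab : (a : ZMod N) ≠ b) (hcd : (c : ZMod N) ≠ d)
    (hbc : (b : ZMod N) = c) : ⁅P.root a b, P.root c d⁆ ∈ P.fullSpan ∧
      ((a : ZMod N) ≠ d → ⁅P.root a b, P.root c d⁆ ∈ P.rootSpan) := by
  obtain ⟨n, rfl⟩ := exists_eq_add_mul hbc
  rw [← P.root_add_mul (b + n * N) d (-n), show b + n * N + -n * N = b by ring]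
  rw [cast_add_mul] at hcd
  obtain ⟨e, he⟩ : ∃ e, e = d + -n * N := ⟨_, rfl⟩
  have hde : (e : ZMod N) = d := by rw [he, cast_add_mul]
  rw [← he, ← hde]
  rw [← hde] at hcd
  have key : (a : ZMod N) ≠ e → ⁅P.root a b, P.root b e⁆ ∈ P.rootSpan := fun h => by
    rw [P.lie_root hab hcd h]
    exact P.root_mem h
  refine ⟨?_, key⟩
  by_cases h : (a : ZMod N) = e
  · obtain ⟨m, rfl⟩ := exists_eq_add_mul h
    exact P.imag_mem m hab
  · exact P.rootSpan_le (key h)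

/-- The second clause serves the Leibniz expansion of a bracket with an imaginary vector, whose
terms then stay brackets of two elements of `rootSpan`. -/
theorem lie_root_mem {a b c d : ℤ} (hab : (a : ZMod N) ≠ b) (hcd : (c : ZMod N) ≠ d) :
    ⁅P.root a b, P.root c d⁆ ∈ P.fullSpan ∧
      (¬((a : ZMod N) = c ∧ (b : ZMod N) = d) → ¬((a : ZMod N) = d ∧ (b : ZMod N) = c) →
        ⁅P.root a b, P.root c d⁆ ∈ P.rootSpan) := by
  by_cases h1 : (b : ZMod N) = c
  · obtain ⟨h, h'⟩ := P.lie_root_of_adjacent hab hcd h1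
    exact ⟨h, fun _ k => h' (by tauto)⟩
  by_cases h2 : (b : ZMod N) = d
  · obtain ⟨h, h'⟩ := P.lie_root_of_adjacent hab hcd.symm h2
    rw [P.root_antisymm c d, lie_neg, neg_mem_iff, neg_mem_iff]
    exact ⟨h, fun k _ => h' (by tauto)⟩
  by_cases h3 : (a : ZMod N) = c
  · obtain ⟨h, h'⟩ := P.lie_root_of_adjacent hab.symm hcd h3
    rw [P.root_antisymm a b, neg_lie, neg_mem_iff, neg_mem_iff]
    exact ⟨h, fun k _ => h' (by tauto)⟩
  by_cases h4 : (a : ZMod N) = d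
  · obtain ⟨h, h'⟩ := P.lie_root_of_adjacent hab.symm hcd.symm h4
    rw [P.root_antisymm a b, P.root_antisymm c d, neg_lie, lie_neg, neg_neg]
    exact ⟨h, fun _ k => h' (by tauto)⟩
  · rw [P.lie_root_of_disjoint hab h3 h4 h1 h2 hcd]
    exact ⟨zero_mem _, fun _ _ => zero_mem _⟩

theorem lie_mem_of_mem_rootSpan {x y : A} (hx : x ∈ P.rootSpan) (hy : y ∈ P.rootSpan) :
    ⁅x, y⁆ ∈ P.fullSpan := by
  unfold rootSpan at hx hy
  induction hx, hy using Submodule.span_induction₂ with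
  | mem_mem x y hx hy =>
    obtain ⟨i, j, hij, rfl⟩ := hx
    obtain ⟨k, l, hkl, rfl⟩ := hy
    exact (P.lie_root_mem hij hkl).1
  | zero_left => rw [zero_lie]; exact zero_mem _
  | zero_right => rw [lie_zero]; exact zero_mem _
  | add_left x y z _ _ _ h h' => rw [add_lie]; exact add_mem h h'
  | add_right x y z _ _ _ h h' => rw [lie_add]; exact add_mem h h'
  | smul_left r x y _ _ h => rw [smul_lie]; exact Submodule.smul_mem _ _ h
  | smul_right r x y _ _ h => rw [lie_smul]; exact Submodule.smul_mem _ _ h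

theorem lie_root_imag_mem_of_ne {a b i j : ℤ} (n : ℤ) (hab : (a : ZMod N) ≠ b)
    (hij : (i : ZMod N) ≠ j) (h1 : ¬((a : ZMod N) = i ∧ (b : ZMod N) = j))
    (h2 : ¬((a : ZMod N) = j ∧ (b : ZMod N) = i)) :
    ⁅P.root a b, P.imag n i j⁆ ∈ P.fullSpan := by
  have hji : (j : ZMod N) ≠ (i + n * N : ℤ) := by rw [cast_add_mul]; exact hij.symm
  rw [imag, leibniz_lie]
  refine add_mem (P.lie_mem_of_mem_rootSpan ((P.lie_root_mem hab hij).2 h1 h2) (P.root_mem hji))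
    (P.lie_mem_of_mem_rootSpan (P.root_mem hij) ((P.lie_root_mem hab hji).2 ?_ ?_))
  · rwa [cast_add_mul]
  · rwa [cast_add_mul]

theorem lie_root_imag_mem {a b i j : ℤ} (n : ℤ) (hab : (a : ZMod N) ≠ b)
    (hij : (i : ZMod N) ≠ j) : ⁅P.root a b, P.imag n i j⁆ ∈ P.fullSpan := by
  by_cases h : ((a : ZMod N) = i ∧ (b : ZMod N) = j) ∨ ((a : ZMod N) = j ∧ (b : ZMod N) = i)
  · obtain ⟨k, hik, hjk⟩ := P.exists_third i j
    -- When the two pairs of residues coincide, split the imaginary vector through a third residue,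
    -- so that neither summand matches the pair `a, b`.
    rw [← P.imag_add n hik hjk.symm hij, lie_add]
    refine add_mem (P.lie_root_imag_mem_of_ne n hab hik ?_ ?_)
      (P.lie_root_imag_mem_of_ne n hab hjk.symm ?_ ?_) <;> grind
  · exact P.lie_root_imag_mem_of_ne n hab hij (by tauto) (by tauto)

/-- The elements whose bracket preserves `fullSpan` form a Lie subalgebra by Jacobi, and it contains
the generators. So `fullSpan` is an ideal containing the generators, and no bracket of two imaginary
vectors has to be computed. -/
theorem fullSpan_eq_top : P.fullSpan = ⊤ := by
  have hgen : ∀ l : ZMod N, ∃ i : ℤ, (i : ZMod N) ≠ (i + 1 : ℤ) ∧ P.gen l = P.root i (i + 1) := by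
    intro l
    obtain ⟨i, rfl⟩ := ZMod.intCast_surjective l
    exact ⟨i, by push_cast; exact P.ne_succ _, (P.root_succ i).symm⟩
  let K : LieSubalgebra ℂ A :=
    { carrier := {x | ∀ y ∈ P.fullSpan, ⁅x, y⁆ ∈ P.fullSpan}
      add_mem' := fun {a b} ha hb y hy => by rw [add_lie]; exact add_mem (ha y hy) (hb y hy)
      zero_mem' := fun y _ => by rw [zero_lie]; exact zero_mem _
      smul_mem' := fun c x hx y hy => by
        rw [smul_lie]; exact Submodule.smul_mem _ _ (hx y hy)
      lie_mem' := fun {a b} ha hb y hy => by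
        rw [lie_lie]; exact sub_mem (ha _ (hb y hy)) (hb _ (ha y hy)) }
  have hK : K = ⊤ := by
    refine P.generates K fun l y hy => ?_
    obtain ⟨a, ha, hl⟩ := hgen l
    rw [hl]
    obtain ⟨u, hu, v, hv, rfl⟩ := Submodule.mem_sup.1 hy
    rw [lie_add]
    refine add_mem (P.lie_mem_of_mem_rootSpan (P.root_mem ha) hu) ?_
    clear hy
    induction hv using Submodule.span_induction with
    | mem x hx =>
      obtain ⟨n, i, j, hij, rfl⟩ := hx
      exact P.lie_root_imag_mem n ha hij
    | zero => rw [lie_zero]; exact zero_mem _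
    | add x y _ _ h h' => rw [lie_add]; exact add_mem h h'
    | smul r x _ h => rw [lie_smul]; exact Submodule.smul_mem _ _ h
  let M : LieSubalgebra ℂ A :=
    { P.fullSpan with
      lie_mem' := fun {a b} _ hb => by
        have ha : a ∈ K := by rw [hK]; trivial
        exact ha b hb }
  have hM : M = ⊤ := P.generates M fun l => by
    obtain ⟨a, ha, hl⟩ := hgen l
    rw [hl]
    exact P.rootSpan_le (P.root_mem ha)
  rw [eq_top_iff]
  intro x _
  have : x ∈ M := by rw [hM]; trivial
  exact this

end Presentation

/-! ### Vertices of the cycle as residues -/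

section IndexConversion

variable {N : ℕ}

/-- The vertex of the cycle with a given residue. -/
def toFin [NeZero N] (z : ZMod N) : Fin N := ⟨z.val, ZMod.val_lt z⟩

theorem toFin_cast [NeZero N] (i : Fin N) : toFin (i.val : ZMod N) = i :=
  Fin.ext (ZMod.val_cast_of_lt i.isLt)

theorem cast_toFin [NeZero N] (z : ZMod N) : ((toFin z).val : ZMod N) = z :=
  ZMod.natCast_zmod_val z

theorem toFin_injective [NeZero N] : Function.Injective (toFin : ZMod N → Fin N) :=
  fun a b h => by rw [← cast_toFin a, h, cast_toFin]

theorem rot_toFin [NeZero N] (z : ZMod N) (k : ℕ) : rot (toFin z) k = toFin (z + (k : ZMod N)) := by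
  apply Fin.ext
  simp only [rot, toFin, ZMod.val_add, ZMod.val_natCast, Nat.add_mod_mod]

theorem adjacent_toFin [NeZero N] {a b : ZMod N} :
    Adjacent (toFin a) (toFin b) ↔ b = a + 1 ∨ a = b + 1 := by
  simp [Adjacent, rot_toFin, toFin_injective.eq_iff]

end IndexConversion

/-! ### Universal property of the Onsager algebra -/

section UniversalProperty

variable {N : ℕ} {L : Type*} [LieRing L] [LieAlgebra ℂ L]

theorem exists_lift (g : Fin N → L)
    (h1 : ∀ i j, Adjacent i j → ⁅g i, ⁅g i, g j⁆⁆ = g j)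
    (h2 : ∀ i j, ¬Adjacent i j → ⁅g i, g j⁆ = 0) :
    ∃ φ : OnsagerAlgebra N →ₗ⁅ℂ⁆ L, ∀ i, φ (e i) = g i := by
  let F := FreeLieAlgebra.lift ℂ g
  have hF : ∀ i, F (FreeLieAlgebra.of ℂ i) = g i := FreeLieAlgebra.lift_of_apply g
  have hle : relIdeal N ≤ F.ker := by
    refine LieSubmodule.lieSpan_le.2 ?_
    rintro x (⟨i, j, hij, rfl⟩ | ⟨i, j, hij, rfl⟩)
    · simp [LieHom.mem_ker, hF, h1 i j hij]
    · simp [LieHom.mem_ker, hF, h2 i j hij]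
  refine ⟨{ (relIdeal N).toSubmodule.liftQ (F : FreeLieAlgebra ℂ (Fin N) →ₗ[ℂ] L)
      (fun x hx => by simpa using hle hx) with map_lie' := ?_ }, fun i => hF i⟩
  intro x y
  induction x using Submodule.Quotient.induction_on with | _ x =>
  induction y using Submodule.Quotient.induction_on with | _ y =>
  exact F.map_lie x y

theorem lieHom_ext {φ ψ : OnsagerAlgebra N →ₗ⁅ℂ⁆ L} (h : ∀ i, φ (e i) = ψ (e i)) : φ = ψ := by
  let q : FreeLieAlgebra ℂ (Fin N) →ₗ⁅ℂ⁆ OnsagerAlgebra N :=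
    { (LieSubmodule.Quotient.mk' (relIdeal N) : FreeLieAlgebra ℂ (Fin N) →ₗ[ℂ] _) with
      map_lie' := fun {x y} => LieSubmodule.Quotient.mk_bracket (relIdeal N) x y }
  have hq : φ.comp q = ψ.comp q := FreeLieAlgebra.hom_ext h
  ext x
  induction x using Submodule.Quotient.induction_on with | _ x =>
  exact congrArg (fun f : FreeLieAlgebra ℂ (Fin N) →ₗ⁅ℂ⁆ L => f x) hq

/-- The universal property gives a map into `K`; followed by the inclusion it fixes the generators,
so it is the identity. -/
theorem eq_top_of_e_mem (K : LieSubalgebra ℂ (OnsagerAlgebra N)) (h : ∀ i, e i ∈ K)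
    (h1 : ∀ i j : Fin N, Adjacent i j → ⁅e i, ⁅e i, e j⁆⁆ = e j)
    (h2 : ∀ i j : Fin N, ¬Adjacent i j → ⁅e i, e j⁆ = 0) : K = ⊤ := by
  obtain ⟨φ, hφ⟩ := exists_lift (fun i => (⟨e i, h i⟩ : K))
    (fun i j hij => Subtype.ext (h1 i j hij)) (fun i j hij => Subtype.ext (h2 i j hij))
  have hid : K.incl.comp φ = LieHom.id := lieHom_ext fun i => by simp [hφ]
  rw [eq_top_iff]
  intro x _
  have := congrArg (fun f : OnsagerAlgebra N →ₗ⁅ℂ⁆ OnsagerAlgebra N => f x) hid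
  change ((φ x : K) : OnsagerAlgebra N) = x at this
  rw [← this]
  exact (φ x).2

theorem lie_e_adj {i j : Fin N} (h : Adjacent i j) :
    (⁅e i, ⁅e i, e j⁆⁆ : OnsagerAlgebra N) = e j := by
  have : (LieSubmodule.Quotient.mk (⁅FreeLieAlgebra.of ℂ i, ⁅FreeLieAlgebra.of ℂ i,
      FreeLieAlgebra.of ℂ j⁆⁆ - FreeLieAlgebra.of ℂ j) : OnsagerAlgebra N) = 0 :=
    LieSubmodule.Quotient.mk_eq_zero'.2 (LieSubmodule.subset_lieSpan (Or.inl ⟨i, j, h, rfl⟩))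
  exact sub_eq_zero.1 this

theorem lie_e_comm {i j : Fin N} (h : ¬Adjacent i j) :
    (⁅e i, e j⁆ : OnsagerAlgebra N) = 0 :=
  LieSubmodule.Quotient.mk_eq_zero'.2 (LieSubmodule.subset_lieSpan (Or.inr ⟨i, j, h, rfl⟩))

theorem exists_lift_of_isDolanGrady [NeZero N] {g : ZMod N → L} (hg : IsDolanGrady g) :
    ∃ φ : OnsagerAlgebra N →ₗ⁅ℂ⁆ L, ∀ z, φ (Complex.I • e (toFin z)) = g z := by
  obtain ⟨φ, hφ⟩ := exists_lift (fun i : Fin N => (-Complex.I) • g i.val)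
    (fun i j hij => by
      rw [← toFin_cast i, ← toFin_cast j, adjacent_toFin] at hij
      simp only [smul_lie, lie_smul, hg.adj hij, smul_smul, smul_neg]
      simp)
    (fun i j hij => by
      rw [← toFin_cast i, ← toFin_cast j, adjacent_toFin] at hij
      simp only [smul_lie, lie_smul, hg.comm' hij, smul_zero])
  refine ⟨φ, fun z => ?_⟩
  rw [map_smul, hφ, smul_smul, cast_toFin]
  simp

/-- The Onsager algebra with its generators in the compact normalisation. -/
noncomputable def presentation (N : ℕ) [NeZero N] (hN : 3 ≤ N) :
    Presentation N (OnsagerAlgebra N) where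
  three_le := hN
  gen z := Complex.I • e (toFin z)
  rel := by
    refine IsDolanGrady.of_adj (fun i j hij => ?_) (fun i j hij => ?_)
    · simp only [smul_lie, lie_smul, lie_e_adj (adjacent_toFin.2 hij), smul_smul]
      simp
    · simp only [smul_lie, lie_smul, lie_e_comm (mt adjacent_toFin.1 hij), smul_zero]
  lift g hg := exists_lift_of_isDolanGrady hg
  generates K hK := by
    refine eq_top_of_e_mem K (fun i => ?_) (fun _ _ => lie_e_adj) (fun _ _ => lie_e_comm)
    have := K.smul_mem (-Complex.I) (hK i.val)
    rwa [smul_smul, toFin_cast, neg_mul, Complex.I_mul_I, neg_neg, one_smul] at this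

end UniversalProperty

/-! ### Brackets of matrix units -/

section MatrixUnits

variable {N : ℕ}

theorem E_val {i j : Fin N} (h : i ≠ j) : (E i j).val = Matrix.single i j (1 : ℂ) := coe_E h

theorem lie_E_E {i j k : Fin N} (hij : i ≠ j) (hjk : j ≠ k) (hik : i ≠ k) :
    ⁅E i j, E j k⁆ = E i k := by
  apply Subtype.ext
  rw [LieAlgebra.SpecialLinear.sl_bracket, E_val hij, E_val hjk, E_val hik,
    Matrix.single_mul_single_same, Matrix.single_mul_single_of_ne _ _ _ _ hik.symm, mul_one, sub_zero]

theorem lie_E_E_of_ne {i j k l : Fin N} (hjk : j ≠ k) (hil : i ≠ l) : ⁅E i j, E k l⁆ = 0 := by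
  by_cases hij : i = j
  · rw [E, dif_neg (not_not.2 hij), zero_lie]
  by_cases hkl : k = l
  · rw [E.eq_def k l, dif_neg (not_not.2 hkl), lie_zero]
  apply Subtype.ext
  rw [LieAlgebra.SpecialLinear.sl_bracket, E_val hij, E_val hkl,
    Matrix.single_mul_single_of_ne _ _ _ _ hjk, Matrix.single_mul_single_of_ne _ _ _ _ hil.symm,
    sub_zero]
  rfl

theorem lie_E_E_symm {i j : Fin N} (hij : i ≠ j) :
    ⁅E i j, E j i⁆ = LieAlgebra.SpecialLinear.singleSubSingle i j (1 : ℂ) := by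
  apply Subtype.ext
  rw [LieAlgebra.SpecialLinear.sl_bracket, E_val hij, E_val hij.symm,
    Matrix.single_mul_single_same, Matrix.single_mul_single_same, mul_one,
    LieAlgebra.SpecialLinear.val_singleSubSingle]

theorem lie_E_H {i j : Fin N} (hij : i ≠ j) (hj : j ≠ rot j 1) (hi : i ≠ rot j 1) :
    ⁅E i j, H j⁆ = E i j := by
  rw [H, ← lie_E_E_symm hj, leibniz_lie, lie_E_E hij hj hi, lie_E_E hi hj.symm hij,
    lie_E_E_of_ne hj hij, lie_zero, add_zero]

theorem lie_E_H' {i j : Fin N} (hij : i ≠ j) (hj : j ≠ rot j 1) (hi : i ≠ rot j 1) :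
    ⁅E j i, H j⁆ = -E j i := by
  rw [H, ← lie_E_E_symm hj, leibniz_lie, lie_E_E_of_ne hij hj, zero_lie, zero_add,
    ← lie_skew (E j i), lie_E_E hj.symm hij.symm hi.symm, lie_neg, lie_E_E hj hi.symm hij.symm]

end MatrixUnits

theorem lie_sub_smul_eq {L : Type*} [LieRing L] [LieAlgebra ℂ L] {x x' y y' u v : L}
    (a b c d : ℂ) (h1 : ⁅x, y⁆ = u) (h2 : ⁅x, y'⁆ = 0) (h3 : ⁅x', y⁆ = 0) (h4 : ⁅x', y'⁆ = v) :
    ⁅a • x - b • x', c • y - d • y'⁆ = (a * c) • u + (b * d) • v := by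
  simp only [sub_lie, lie_sub, smul_lie, lie_smul, h1, h2, h3, h4]
  module

/-! ### Periodic matrix units in the loop algebra -/

section PeriodicUnits

variable {N : ℕ} [NeZero N]

/-- The periodic matrix unit with integer indices. -/
noncomputable def El (N : ℕ) [NeZero N] (i j : ℤ) : LoopSl N :=
  LaurentPolynomial.T (j / N - i / N) ⊗ₜ E (toFin (i : ZMod N)) (toFin (j : ZMod N))

theorem toFin_ne {i j : ℤ} (h : (i : ZMod N) ≠ j) :
    toFin (i : ZMod N) ≠ toFin (j : ZMod N) := toFin_injective.ne h

theorem add_mul_ediv (i n : ℤ) : (i + n * N) / (N : ℤ) = i / N + n :=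
  Int.add_mul_ediv_right _ _ (by exact_mod_cast NeZero.ne N)

theorem lie_El {i j k : ℤ} (hij : (i : ZMod N) ≠ j) (hjk : (j : ZMod N) ≠ k)
    (hik : (i : ZMod N) ≠ k) : ⁅El N i j, El N j k⁆ = El N i k := by
  rw [El, El, LieAlgebra.ExtendScalars.bracket_tmul,
    lie_E_E (toFin_ne hij) (toFin_ne hjk) (toFin_ne hik), ← LaurentPolynomial.T_add, El]
  congr 2
  ring

theorem lie_El_of_ne {i j k l : ℤ} (hjk : (j : ZMod N) ≠ k) (hil : (i : ZMod N) ≠ l) :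
    ⁅El N i j, El N k l⁆ = 0 := by
  rw [El, El, LieAlgebra.ExtendScalars.bracket_tmul, lie_E_E_of_ne (toFin_ne hjk) (toFin_ne hil),
    TensorProduct.tmul_zero]

theorem lie_El_imag {i j : ℤ} (n : ℤ) (hij : (i : ZMod N) ≠ j) :
    ⁅El N i j, El N j (i + n * N)⁆ = LaurentPolynomial.T n ⊗ₜ
      LieAlgebra.SpecialLinear.singleSubSingle (toFin (i : ZMod N)) (toFin (j : ZMod N)) 1 := by
  rw [El, El, LieAlgebra.ExtendScalars.bracket_tmul, Presentation.cast_add_mul,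
    lie_E_E_symm (toFin_ne hij), ← LaurentPolynomial.T_add, add_mul_ediv]
  congr 2
  ring

theorem El_shift (i j n : ℤ) : El N (i + n * N) (j + n * N) = El N i j := by
  rw [El, El, Presentation.cast_add_mul, Presentation.cast_add_mul, add_mul_ediv, add_mul_ediv]
  congr 2
  ring

theorem toFin_val (i : ℤ) : ((toFin (i : ZMod N)).val : ℤ) = i % N := ZMod.val_intCast i

theorem neg_one_zpow_congr {a b : ℤ} (h : Even (a - b)) : (-1 : ℂ) ^ a = (-1 : ℂ) ^ b := by
  rw [← sub_add_cancel a b, zpow_add₀ (by norm_num), h.neg_one_zpow, one_mul]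

theorem omega_El {i j : ℤ} (hij : (i : ZMod N) ≠ j) :
    omega N (El N i j) = (-1 : ℂ) ^ (i + j + 1) • El N j i := by
  rw [El, omega_E (toFin_ne hij), El, toFin_val, toFin_val, neg_sub]
  congr 1
  apply neg_one_zpow_congr
  have hi := Int.emod_add_mul_ediv i N
  have hj := Int.emod_add_mul_ediv j N
  exact ⟨-(i / N * N), by linear_combination hi + hj⟩

open Complex in
/-- The image of `root i j` in the loop algebra. -/
noncomputable def loopRoot (N : ℕ) [NeZero N] (i j : ℤ) : LoopSl N :=
  I ^ (j - i) • El N i j - I ^ (i - j) • El N j i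

theorem loopRoot_antisymm (i j : ℤ) : loopRoot N i j = -loopRoot N j i := by
  rw [loopRoot, loopRoot, neg_sub]

theorem loopRoot_shift (i j n : ℤ) : loopRoot N (i + n * N) (j + n * N) = loopRoot N i j := by
  rw [loopRoot, loopRoot, El_shift, El_shift, add_sub_add_right_eq_sub, add_sub_add_right_eq_sub]

theorem lie_loopRoot {i j k : ℤ} (hij : (i : ZMod N) ≠ j) (hjk : (j : ZMod N) ≠ k)
    (hik : (i : ZMod N) ≠ k) : ⁅loopRoot N i j, loopRoot N j k⁆ = loopRoot N i k := by
  have e : ⁅El N j i, El N k j⁆ = -El N k i := by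
    rw [← lie_skew, lie_El hjk.symm hij.symm hik.symm]
  refine (lie_sub_smul_eq _ _ _ _ (lie_El hij hjk hik) (lie_El_of_ne hjk hij)
    (lie_El_of_ne hij hjk) e).trans ?_
  rw [loopRoot, ← zpow_add₀ Complex.I_ne_zero, ← zpow_add₀ Complex.I_ne_zero,
    show j - i + (k - j) = k - i by ring, show i - j + (j - k) = i - k by ring]
  module

theorem lie_loopRoot_of_disjoint {a b c d : ℤ} (hac : (a : ZMod N) ≠ c)
    (had : (a : ZMod N) ≠ d) (hbc : (b : ZMod N) ≠ c) (hbd : (b : ZMod N) ≠ d) :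
    ⁅loopRoot N a b, loopRoot N c d⁆ = 0 := by
  refine (lie_sub_smul_eq _ _ _ _ (lie_El_of_ne hbc had) (lie_El_of_ne hbd hac)
    (lie_El_of_ne hac hbd) (lie_El_of_ne had hbc)).trans ?_
  module

theorem lie_loopRoot_imag {i j : ℤ} (n : ℤ) (hij : (i : ZMod N) ≠ j) :
    ⁅loopRoot N i j, loopRoot N j (i + n * N)⁆ =
      (Complex.I ^ (n * N) • LaurentPolynomial.T n - Complex.I ^ (-(n * N)) •
        LaurentPolynomial.T (-n)) ⊗ₜ
      LieAlgebra.SpecialLinear.singleSubSingle (toFin (i : ZMod N)) (toFin (j : ZMod N)) 1 := by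
  have hc : ((i + n * N : ℤ) : ZMod N) = i := Presentation.cast_add_mul _ _
  have e : ⁅El N j i, El N (i + n * N) j⁆ = -(LaurentPolynomial.T (-n) ⊗ₜ
      LieAlgebra.SpecialLinear.singleSubSingle (toFin (i : ZMod N)) (toFin (j : ZMod N)) 1) := by
    have := lie_El_imag (i := i + n * N) (j := j) (-n) (by rwa [hc])
    rw [hc, show i + n * N + -n * (N : ℤ) = i by ring] at this
    rw [← this, ← lie_skew]
  refine (lie_sub_smul_eq _ _ _ _ (lie_El_imag n hij)
    (lie_El_of_ne (by rw [hc]; exact hij.symm) hij)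
    (lie_El_of_ne hij (by rw [hc]; exact hij.symm)) e).trans ?_
  rw [TensorProduct.sub_tmul, ← TensorProduct.smul_tmul', ← TensorProduct.smul_tmul',
    ← zpow_add₀ Complex.I_ne_zero, ← zpow_add₀ Complex.I_ne_zero,
    show j - i + (i + n * N - j) = n * N by ring,
    show i - j + (j - (i + n * N)) = -(n * N) by ring]
  module

theorem I_zpow_mul_neg_one_zpow (i j : ℤ) :
    Complex.I ^ (j - i) * (-1 : ℂ) ^ (i + j + 1) = -Complex.I ^ (i - j) := by
  have h : (-1 : ℂ) ^ (i + j + 1) = -(Complex.I ^ (i - j) * Complex.I ^ (i - j)) := by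
    rw [zpow_add_one₀ (by norm_num), mul_neg_one, ← mul_zpow, Complex.I_mul_I]
    congr 1
    exact neg_one_zpow_congr ⟨j, by ring⟩
  have h2 : Complex.I ^ (j - i) * Complex.I ^ (i - j) = 1 := by
    rw [← zpow_add₀ Complex.I_ne_zero]; simp
  rw [h]
  linear_combination (-Complex.I ^ (i - j)) * h2

/-- The involution exchanges the two terms, and the powers of `Complex.I` absorb its sign. As their
exponents add along `i, j, k`, they do not disturb the multiplication rule. -/
theorem omega_loopRoot {i j : ℤ} (hij : (i : ZMod N) ≠ j) :
    omega N (loopRoot N i j) = loopRoot N i j := by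
  rw [loopRoot, map_sub, map_smul, map_smul, omega_El hij, omega_El hij.symm, smul_smul,
    smul_smul, I_zpow_mul_neg_one_zpow, I_zpow_mul_neg_one_zpow]
  module

end PeriodicUnits

/-! ### The realization of the generators -/

section Realization

variable {N : ℕ} [NeZero N]

theorem loopRoot_mem {i j : ℤ} (hij : (i : ZMod N) ≠ j) :
    loopRoot N i j ∈ fixedSubalgebra N :=
  mem_fixedSubalgebra.2 (omega_loopRoot hij)

omit [NeZero N] in
theorem loop_neg_lie (x y : LoopSl N) : ⁅-x, y⁆ = -⁅x, y⁆ := neg_lie x y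

omit [NeZero N] in
theorem loop_lie_neg (x y : LoopSl N) : ⁅x, -y⁆ = -⁅x, y⁆ := lie_neg x y

omit [NeZero N] in
theorem cast_ne_cast_succ (h1 : (1 : ZMod N) ≠ 0) (i : ℤ) :
    (i : ZMod N) ≠ ((i + 1 : ℤ) : ZMod N) := by
  push_cast
  simpa using h1

/-- The images of the generators in the fixed-point subalgebra. -/
noncomputable def loopGen (h1 : (1 : ZMod N) ≠ 0) (z : ZMod N) : fixedSubalgebra N :=
  ⟨loopRoot N z.val (z.val + 1), loopRoot_mem (cast_ne_cast_succ h1 _)⟩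

theorem loopGen_cast (h1 : (1 : ZMod N) ≠ 0) (i : ℤ) :
    (loopGen h1 (i : ZMod N) : LoopSl N) = loopRoot N i (i + 1) := by
  have h : (((i : ZMod N).val : ℤ)) = i + -(i / N) * N := by
    rw [ZMod.val_intCast]
    linarith [Int.emod_add_mul_ediv i N]
  change loopRoot N _ _ = _
  rw [h, add_right_comm, loopRoot_shift]

theorem loopGen_isDolanGrady (h1 : (1 : ZMod N) ≠ 0) (h2 : (2 : ZMod N) ≠ 0) :
    IsDolanGrady (loopGen h1) := by
  have s1 := cast_ne_cast_succ h1
  have s2 : ∀ i : ℤ, (i : ZMod N) ≠ ((i + 1 + 1 : ℤ) : ZMod N) := fun i h => by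
    push_cast at h
    exact h2 (by linear_combination -h)
  refine ⟨fun z => ?_, fun z => ?_, fun z w hzw hwz => ?_⟩
  · obtain ⟨i, rfl⟩ := ZMod.intCast_surjective z
    have e := loopGen_cast h1 (i + 1)
    push_cast at e
    apply Subtype.ext
    change ⁅(loopGen h1 (i : ZMod N) : LoopSl N), ⁅(loopGen h1 (i : ZMod N) : LoopSl N),
      (loopGen h1 ((i : ZMod N) + 1) : LoopSl N)⁆⁆ = -(loopGen h1 ((i : ZMod N) + 1) : LoopSl N)
    rw [e, loopGen_cast, lie_loopRoot (s1 i) (s1 _) (s2 i), loopRoot_antisymm i (i + 1)]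
    rw [loop_neg_lie, lie_loopRoot (s1 i).symm (s2 i) (s1 _)]
  · obtain ⟨i, rfl⟩ := ZMod.intCast_surjective z
    have e := loopGen_cast h1 (i + 1)
    push_cast at e
    apply Subtype.ext
    change ⁅(loopGen h1 ((i : ZMod N) + 1) : LoopSl N), ⁅(loopGen h1 ((i : ZMod N) + 1) : LoopSl N),
      (loopGen h1 (i : ZMod N) : LoopSl N)⁆⁆ = -(loopGen h1 (i : ZMod N) : LoopSl N)
    rw [e, loopGen_cast, loopRoot_antisymm (i + 1) (i + 1 + 1), loopRoot_antisymm i (i + 1)]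
    have k1 := lie_loopRoot (s1 (i + 1)).symm (s1 i).symm (s2 i).symm
    have k2 := lie_loopRoot (s1 (i + 1)) (s2 i).symm (s1 i).symm
    rw [loopRoot_antisymm (i + 1) (i + 1 + 1), loop_neg_lie] at k2
    rw [loop_neg_lie, loop_neg_lie, loop_lie_neg, loop_lie_neg, neg_neg, k1, loop_lie_neg, k2,
      neg_neg]

  · obtain ⟨i, rfl⟩ := ZMod.intCast_surjective z
    obtain ⟨j, rfl⟩ := ZMod.intCast_surjective w
    apply Subtype.ext
    change ⁅(loopGen h1 (i : ZMod N) : LoopSl N), (loopGen h1 (j : ZMod N) : LoopSl N)⁆ = 0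
    by_cases hij : (i : ZMod N) = j
    · rw [hij]
      exact lie_self _
    rw [loopGen_cast, loopGen_cast]
    refine lie_loopRoot_of_disjoint hij ?_ ?_ ?_ <;> push_cast
    · exact hwz
    · exact hzw.symm
    · exact fun h => hij (add_right_cancel h)

/-- The matrix units off the diagonal and the differences of diagonal units. -/
noncomputable def slUnit (i j : Fin N) : sl (Fin N) ℂ :=
  if i = j then LieAlgebra.SpecialLinear.singleSubSingle i (toFin 0) 1 else E i j

/-- The diagonal units are corrected at the base index, and the corrections add up to the trace,
which is zero. -/
theorem sum_slUnit (X : sl (Fin N) ℂ) : X = ∑ i, ∑ j, X.val i j • slUnit i j := by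
  have htr : ∑ i, X.val i i = 0 := X.2
  apply Subtype.ext
  have hsplit : ∀ i j, (X.val i j • slUnit i j).val = X.val i j • Matrix.single i j (1 : ℂ) -
      (if i = j then X.val i i else 0) • Matrix.single (toFin 0) (toFin 0) (1 : ℂ) := by
    intro i j
    by_cases h : i = j
    · subst h
      rw [slUnit, if_pos rfl, if_pos rfl, ← smul_sub]
      rfl
    · rw [slUnit, if_neg h, if_neg h, zero_smul, sub_zero, ← coe_E h]
      rfl
  have hcoe : (∑ i, ∑ j, X.val i j • slUnit i j).val =
      ∑ i, ∑ j, (X.val i j • slUnit i j).val := by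
    simp only [AddSubmonoidClass.coe_finsetSum]
  rw [hcoe]
  simp only [hsplit, Finset.sum_sub_distrib, ← Finset.sum_smul, Finset.sum_ite_eq,
    Finset.mem_univ, if_true, htr, zero_smul, sub_zero]
  conv_lhs => rw [Matrix.matrix_eq_sum_single X.val]
  simp

end Realization

open LieAlgebra.SpecialLinear (singleSubSingle)

/-! ### The inverse up to a factor two -/

section Isomorphism

variable {N : ℕ} [NeZero N]

theorem El_fin (a b : Fin N) (n : ℤ) :
    El N a.val (b.val + n * N) = LaurentPolynomial.T n ⊗ₜ E a b := by
  have hdiv : ∀ c : Fin N, ((c.val : ℤ)) / (N : ℤ) = 0 := fun c =>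
    Int.ediv_eq_zero_of_lt (by omega) (by exact_mod_cast c.isLt)
  rw [El, Presentation.cast_add_mul, add_mul_ediv, hdiv, hdiv]
  simp only [Int.cast_natCast, toFin_cast, zero_add, sub_zero]

omit [NeZero N] in
theorem omega_imag {a b : Fin N} (hab : a ≠ b) (n : ℤ) :
    omega N (LaurentPolynomial.T n ⊗ₜ singleSubSingle a b 1) =
      -((-1 : ℂ) ^ (n * (N : ℤ)) • (LaurentPolynomial.T (-n) ⊗ₜ singleSubSingle a b 1)) := by
  have h : omega₂ N (singleSubSingle a b 1) = -singleSubSingle a b 1 := by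
    rw [← lie_E_E_symm hab, LieHom.map_lie, omega₂_E hab, omega₂_E hab.symm, smul_lie, lie_smul,
      smul_smul, ← pow_add, Even.neg_one_pow ⟨a.val + b.val + 1, by ring⟩, one_smul, lie_skew]
  rw [omega, LieAlgebra.ExtendScalars.map_apply_tmul, omega₁_T, h, TensorProduct.tmul_neg,
    ← TensorProduct.smul_tmul']

theorem cast_val_ne {a b : Fin N} (h : a ≠ b) : ((a.val : ℤ) : ZMod N) ≠ ((b.val : ℤ) : ZMod N) := by
  intro h'
  push_cast at h'
  exact h (by rw [← toFin_cast a, h', toFin_cast])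

variable {A : Type*} [LieRing A] [LieAlgebra ℂ A] (P : Presentation N A)

section
variable {h1 : (1 : ZMod N) ≠ 0} {π : A →ₗ⁅ℂ⁆ fixedSubalgebra N}
  (hπ : ∀ z, π (P.gen z) = loopGen h1 z)
include hπ

/-- Both families obey the same product rule, so it suffices to factor through an intermediate
index: `i + 1`, or `i + 2` when `i + 1 ≡ j`. -/
theorem map_root_of_lt (n : ℕ) : ∀ i j : ℤ, i < j → (i : ZMod N) ≠ j → j ≤ i + n →
    (π (P.root i j) : LoopSl N) = loopRoot N i j := by
  have h2 := P.two_ne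
  induction n with
  | zero => intro i j h _ h'; push_cast at h'; omega
  | succ n ih =>
    intro i j hij hne hn
    by_cases hj : j = i + 1
    · rw [hj, P.root_succ, hπ, loopGen_cast]
    have key : ∀ k : ℤ, i < k → k < j → (i : ZMod N) ≠ k → (k : ZMod N) ≠ j →
        (π (P.root i j) : LoopSl N) = loopRoot N i j := by
      intro k hik hkj hik' hkj'
      rw [← P.lie_root hik' hkj' hne, LieHom.map_lie]
      change ⁅(π (P.root i k) : LoopSl N), (π (P.root k j) : LoopSl N)⁆ = _
      rw [ih i k hik hik' (by push_cast at hn; omega), ih k j hkj hkj' (by push_cast at hn; omega),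
        lie_loopRoot hik' hkj' hne]
    by_cases hj' : ((i + 1 : ℤ) : ZMod N) = j
    · have hne2 : ((i + 2 : ℤ) : ZMod N) ≠ j := by
        rw [← hj']
        push_cast
        exact fun h => h1 (by linear_combination h)
      refine key (i + 2) (by omega) ?_ ?_ hne2
      · have : j ≠ i + 2 := fun h => hne2 (by rw [h])
        omega
      · push_cast
        simpa using h2
    · exact key (i + 1) (by omega) (by omega) (cast_ne_cast_succ h1 i) hj'

theorem map_root {i j : ℤ} (hij : (i : ZMod N) ≠ j) :
    (π (P.root i j) : LoopSl N) = loopRoot N i j := by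
  rcases lt_trichotomy i j with h | rfl | h
  · exact map_root_of_lt P hπ (j - i).toNat i j h hij (by omega)
  · exact absurd rfl hij
  · rw [P.root_antisymm, loopRoot_antisymm, map_neg,
      ← map_root_of_lt P hπ (i - j).toNat j i h hij.symm (by omega)]
    rfl

theorem map_imag (n : ℤ) {i j : ℤ} (hij : (i : ZMod N) ≠ j) :
    (π (P.imag n i j) : LoopSl N) =
      (Complex.I ^ (n * N) • LaurentPolynomial.T n - Complex.I ^ (-(n * N)) •
        LaurentPolynomial.T (-n)) ⊗ₜ
      singleSubSingle (toFin (i : ZMod N)) (toFin (j : ZMod N)) 1 := by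
  rw [← lie_loopRoot_imag n hij, ← map_root P hπ hij,
    ← map_root P hπ (i := j) (j := i + n * N) (by rw [Presentation.cast_add_mul]; exact hij.symm),
    Presentation.imag, LieHom.map_lie]
  rfl

end

/-- The coefficient of `t ^ n` of the section of the realization. -/
noncomputable def sectionCoeff (n : ℤ) : Matrix (Fin N) (Fin N) ℂ →ₗ[ℂ] A where
  toFun X := ∑ i, ∑ j, (Complex.I ^ ((i.val : ℤ) - (j.val + n * N)) * X i j) •
    (if i = j then P.imag n i.val 0 else P.root i.val (j.val + n * N))
  map_add' X Y := by
    simp only [Matrix.add_apply, mul_add, add_smul, Finset.sum_add_distrib]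
  map_smul' c X := by
    simp only [Matrix.smul_apply, smul_eq_mul, RingHom.id_apply, Finset.smul_sum, smul_smul]
    refine Finset.sum_congr rfl fun i _ => Finset.sum_congr rfl fun j _ => ?_
    congr 1
    ring

omit [NeZero N] in
theorem sectionCoeff_single (n : ℤ) (a b : Fin N) : sectionCoeff P n (Matrix.single a b 1) =
    Complex.I ^ ((a.val : ℤ) - (b.val + n * N)) •
      (if a = b then P.imag n a.val 0 else P.root a.val (b.val + n * N)) := by
  rw [sectionCoeff, LinearMap.coe_mk, AddHom.coe_mk, Finset.sum_eq_single a,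
    Finset.sum_eq_single b]
  · simp
  · intro j _ hj
    rw [Matrix.single_apply_of_ne _ _ _ _ _ (by tauto), mul_zero, zero_smul]
  · simp
  · intro i _ hi
    refine Finset.sum_eq_zero fun j _ => ?_
    rw [Matrix.single_apply_of_ne _ _ _ _ _ (by tauto), mul_zero, zero_smul]
  · simp

/-- A linear map from the loop algebra to the presented algebra which is twice the inverse of the
realization on the fixed-point subalgebra. -/
noncomputable def sectionMap : LoopSl N →ₗ[ℂ] A :=
  TensorProduct.lift ((AddMonoidAlgebra.basis ℤ ℂ).constr ℂ fun n =>
    { toFun := fun X => sectionCoeff P n X.val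
      map_add' := fun X Y => map_add (sectionCoeff P n) X.val Y.val
      map_smul' := fun c X => map_smul (sectionCoeff P n) c X.val })

omit [NeZero N] in
theorem sectionMap_T_tmul (n : ℤ) (X : sl (Fin N) ℂ) :
    sectionMap P (LaurentPolynomial.T n ⊗ₜ X) = sectionCoeff P n X.val := by
  have h : (LaurentPolynomial.T n : ℂ[T;T⁻¹]) = AddMonoidAlgebra.basis ℤ ℂ n := rfl
  rw [sectionMap, TensorProduct.lift.tmul, h, Module.Basis.constr_basis]
  rfl

-- The default value of `root` at equal indices makes the diagonal formula of `sectionCoeff` correct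
-- at the base index too.
omit [NeZero N] in
theorem imag_self_zero (n : ℤ) : P.imag n 0 0 = 0 := by
  have h : P.root 0 0 = 0 := by simp [Presentation.root, Presentation.rootAux]
  rw [Presentation.imag, h, zero_lie]

theorem imag_sub_imag {a b : Fin N} (hab : a ≠ b) (n : ℤ) :
    P.imag n a.val 0 - P.imag n b.val 0 = P.imag n a.val b.val := by
  have key : ∀ c : Fin N, c.val = 0 ∨ ((c.val : ℤ) : ZMod N) ≠ ((0 : ℤ) : ZMod N) := by
    intro c
    by_cases hc : c.val = 0
    · exact Or.inl hc
    · have := cast_val_ne (a := c) (b := ⟨0, NeZero.pos N⟩) (fun h => hc (congrArg Fin.val h))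
      exact Or.inr (by simpa using this)
  have hab' := cast_val_ne hab
  rcases key a with ha | ha
  · rw [ha] at hab' ⊢
    rw [Int.natCast_zero, imag_self_zero, zero_sub, ← P.imag_antisymm n (by simpa using hab')]
  rcases key b with hb | hb
  · rw [hb, Int.natCast_zero, imag_self_zero, sub_zero]
  · rw [← P.imag_add n hab' hb ha, add_sub_cancel_right]

theorem sectionMap_El {i j : ℤ} (hij : (i : ZMod N) ≠ j) :
    sectionMap P (El N i j) = Complex.I ^ (i - j) • P.root i j := by
  have hi := Int.emod_add_mul_ediv i N
  have hj := Int.emod_add_mul_ediv j N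
  rw [El, sectionMap_T_tmul, coe_E (toFin_ne hij), sectionCoeff_single, if_neg (toFin_ne hij),
    ← P.root_add_mul _ _ (i / N), toFin_val, toFin_val]
  have e1 : i % N + i / N * N = i := by linarith
  have e2 : j % N + (j / N - i / N) * N + i / N * N = j := by linarith
  rw [e1, e2]
  congr 2
  linear_combination e1 - e2

theorem sectionMap_imag {a b : Fin N} (hab : a ≠ b) (n : ℤ) :
    sectionMap P (LaurentPolynomial.T n ⊗ₜ singleSubSingle a b 1) =
      Complex.I ^ (-(n * (N : ℤ))) • P.imag n a.val b.val := by
  rw [sectionMap_T_tmul, LieAlgebra.SpecialLinear.val_singleSubSingle, map_sub,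
    sectionCoeff_single, sectionCoeff_single, if_pos rfl, if_pos rfl, ← imag_sub_imag P hab,
    smul_sub]
  congr 3 <;> ring

section
variable {h1 : (1 : ZMod N) ≠ 0} {π : A →ₗ⁅ℂ⁆ fixedSubalgebra N}
  (hπ : ∀ z, π (P.gen z) = loopGen h1 z)
include hπ

/-- The two halves of `loopRoot` go to `root i j` and `-root j i`, which coincide; hence the factor
two. -/
theorem sectionMap_map_root {i j : ℤ} (hij : (i : ZMod N) ≠ j) :
    sectionMap P (π (P.root i j)) = (2 : ℂ) • P.root i j := by
  have e : ∀ a b : ℤ, Complex.I ^ (a - b) * Complex.I ^ (b - a) = 1 := fun a b => by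
    rw [← zpow_add₀ Complex.I_ne_zero]; simp
  rw [map_root P hπ hij, loopRoot, map_sub, map_smul, map_smul, sectionMap_El P hij,
    sectionMap_El P hij.symm, smul_smul, smul_smul, e, e, P.root_antisymm j i]
  module

theorem sectionMap_map_imag (n : ℤ) {i j : ℤ} (hij : (i : ZMod N) ≠ j) :
    sectionMap P (π (P.imag n i j)) = (2 : ℂ) • P.imag n i j := by
  have e : ∀ a : ℤ, Complex.I ^ a * Complex.I ^ (-a) = 1 := fun a => by
    rw [← zpow_add₀ Complex.I_ne_zero]; simp
  have hi := Int.emod_add_mul_ediv i N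
  have hj := Int.emod_add_mul_ediv j N
  have key : ∀ m, P.imag m (toFin (i : ZMod N)).val (toFin (j : ZMod N)).val = P.imag m i j := by
    intro m
    rw [toFin_val, toFin_val, ← P.imag_add_mul_left m (i := i) hij (-(i / N)),
      show i + -(i / N) * N = i % N by linarith,
      ← P.imag_add_mul_right m (j := j) _ (-(j / N)), show j + -(j / N) * N = j % N by linarith]
    rwa [show i % N = i + -(i / N) * N by linarith, Presentation.cast_add_mul]
  rw [map_imag P hπ n hij, TensorProduct.sub_tmul, ← TensorProduct.smul_tmul',
    ← TensorProduct.smul_tmul', map_sub, map_smul, map_smul, sectionMap_imag P (toFin_ne hij),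
    sectionMap_imag P (toFin_ne hij), key, key, smul_smul, smul_smul, e, neg_mul n, e,
    P.imag_neg n hij]
  module

theorem sectionMap_map (x : A) : sectionMap P (π x) = (2 : ℂ) • x := by
  have hx : x ∈ P.fullSpan := by rw [P.fullSpan_eq_top]; trivial
  let f : A →ₗ[ℂ] A := (sectionMap P).comp
    ((fixedSubalgebra N).toSubmodule.subtype.comp (π : A →ₗ[ℂ] fixedSubalgebra N))
  have hle : P.fullSpan ≤ LinearMap.eqLocus f ((2 : ℂ) • LinearMap.id) := by
    refine sup_le (Submodule.span_le.2 ?_) (Submodule.span_le.2 ?_)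
    · rintro _ ⟨i, j, hij, rfl⟩
      exact sectionMap_map_root P hπ hij
    · rintro _ ⟨n, i, j, hij, rfl⟩
      exact sectionMap_map_imag P hπ n hij
  exact hle hx

theorem map_sectionMap_slUnit (n : ℤ) (a b : Fin N) :
    (π (sectionMap P (LaurentPolynomial.T n ⊗ₜ slUnit a b)) : LoopSl N) =
      LaurentPolynomial.T n ⊗ₜ slUnit a b + omega N (LaurentPolynomial.T n ⊗ₜ slUnit a b) := by
  by_cases hab : a = b
  · subst hab
    rw [slUnit, if_pos rfl]
    by_cases ha : a = toFin 0
    · have : singleSubSingle a (toFin 0) (1 : ℂ) = 0 := by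
        apply Subtype.ext
        rw [← ha, LieAlgebra.SpecialLinear.val_singleSubSingle, sub_self]
        rfl
      rw [this, TensorProduct.tmul_zero, map_zero, map_zero, map_zero, add_zero]
      rfl
    · have e : Complex.I ^ (-(n * (N : ℤ))) * Complex.I ^ (n * (N : ℤ)) = 1 := by
        rw [← zpow_add₀ Complex.I_ne_zero]; simp
      have e' : Complex.I ^ (-(n * (N : ℤ))) * Complex.I ^ (-(n * (N : ℤ))) =
          (-1 : ℂ) ^ (n * (N : ℤ)) := by
        rw [← mul_zpow, Complex.I_mul_I]
        exact neg_one_zpow_congr ⟨-(n * N), by ring⟩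
      rw [sectionMap_imag P ha, omega_imag ha, map_smul]
      change Complex.I ^ (-(n * (N : ℤ))) • (π (P.imag n a.val (toFin 0).val) : LoopSl N) = _
      rw [map_imag P hπ n (cast_val_ne ha), Int.cast_natCast, Int.cast_natCast, toFin_cast,
        toFin_cast, TensorProduct.sub_tmul, ← TensorProduct.smul_tmul',
        ← TensorProduct.smul_tmul', smul_sub, smul_smul, smul_smul, e, e', one_smul,
        sub_eq_add_neg]
  · have hne : ((a.val : ℤ) : ZMod N) ≠ ((b.val + n * N : ℤ) : ZMod N) := by
      rw [Presentation.cast_add_mul]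
      exact cast_val_ne hab
    rw [slUnit, if_neg hab, ← El_fin, sectionMap_El P hne, omega_El hne, map_smul]
    change Complex.I ^ _ • (π (P.root _ _) : LoopSl N) = _
    rw [map_root P hπ hne, loopRoot, smul_sub, smul_smul, smul_smul]
    have h := I_zpow_mul_neg_one_zpow (b.val + n * N) (a.val : ℤ)
    generalize hi : (a.val : ℤ) = i at *
    generalize hj : ((b.val : ℤ) + n * N) = j at *
    have e : Complex.I ^ (i - j) * Complex.I ^ (j - i) = 1 := by
      rw [← zpow_add₀ Complex.I_ne_zero]; simp
    have e' : (-1 : ℂ) ^ (i + j + 1) = -(Complex.I ^ (i - j) * Complex.I ^ (i - j)) := by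
      have h0 := I_zpow_mul_neg_one_zpow i j
      linear_combination Complex.I ^ (i - j) * h0 - (-1 : ℂ) ^ (i + j + 1) * e
    rw [e, e']
    module

theorem map_sectionMap (y : LoopSl N) : (π (sectionMap P y) : LoopSl N) = y + omega N y := by
  let f : LoopSl N →ₗ[ℂ] LoopSl N := (fixedSubalgebra N).toSubmodule.subtype.comp
    ((π : A →ₗ[ℂ] fixedSubalgebra N).comp (sectionMap P))
  let g : LoopSl N →ₗ[ℂ] LoopSl N := LinearMap.id + (omega N : LoopSl N →ₗ[ℂ] LoopSl N)
  have hT : ∀ (n : ℤ) (X : sl (Fin N) ℂ), f (LaurentPolynomial.T n ⊗ₜ X) =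
      g (LaurentPolynomial.T n ⊗ₜ X) := by
    intro n X
    rw [sum_slUnit X]
    simp only [TensorProduct.tmul_sum, TensorProduct.tmul_smul, map_sum, map_smul]
    refine Finset.sum_congr rfl fun i _ => Finset.sum_congr rfl fun j _ => ?_
    congr 1
    exact map_sectionMap_slUnit P hπ n i j
  suffices f = g from congrArg (fun h : LoopSl N →ₗ[ℂ] LoopSl N => h y) this
  refine TensorProduct.ext' fun p X => ?_
  induction p using LaurentPolynomial.induction_on' with
  | add p q hp hq => rw [TensorProduct.add_tmul, map_add, map_add, hp, hq]
  | C_mul_T n a =>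
    rw [← LaurentPolynomial.smul_eq_C_mul, ← TensorProduct.smul_tmul', map_smul, map_smul, hT]

/-- A fixed point `y` satisfies `y + omega y = 2 y`, so `sectionMap` of half of it is a preimage. -/
theorem map_bijective : Function.Bijective π := by
  constructor
  · rw [injective_iff_map_eq_zero]
    intro x hx
    have h := sectionMap_map P hπ x
    rw [hx] at h
    have h' : (2 : ℂ) • x = 0 := h.symm.trans (map_zero (sectionMap P))
    simpa using h'
  · intro y
    refine ⟨sectionMap P ((1 / 2 : ℂ) • (y : LoopSl N)), Subtype.ext ?_⟩
    have hy : omega N (y : LoopSl N) = y := y.2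
    rw [map_sectionMap P hπ, map_smul, hy]
    module

end

end Isomorphism

/-! ### The explicit strings -/

theorem lie_add_smul_eq {L : Type*} [LieRing L] [LieAlgebra ℂ L] {x x' y y' u v : L} (s : ℂ)
    (h1 : ⁅x, y⁆ = u) (h2 : ⁅x, y'⁆ = 0) (h3 : ⁅x', y⁆ = 0) (h4 : ⁅x', y'⁆ = v) :
    ⁅x + x', y + s • y'⁆ = u + s • v := by
  simp only [add_lie, lie_add, lie_smul, h1, h2, h3, h4]
  module

section Strings

variable {N : ℕ}

theorem loop_lie_smul (u : ℂ[T;T⁻¹]) (x y : LoopSl N) : ⁅x, u • y⁆ = u • ⁅x, y⁆ := lie_smul u x y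

theorem loop_add_lie (x y z : LoopSl N) : ⁅x + y, z⁆ = ⁅x, z⁆ + ⁅y, z⁆ := add_lie x y z

theorem loop_smul_tmul (u p : ℂ[T;T⁻¹]) (x : sl (Fin N) ℂ) :
    (u • (p ⊗ₜ[ℂ] x) : LoopSl N) = (u * p) ⊗ₜ[ℂ] x := by
  rw [TensorProduct.smul_tmul', smul_eq_mul]

variable [NeZero N]

theorem toFin_add (i : Fin N) (k : ℕ) :
    toFin (((i.val : ℤ) + k : ℤ) : ZMod N) = rot i k := by
  conv_rhs => rw [← toFin_cast i, rot_toFin]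
  push_cast
  rfl

omit [NeZero N] in
theorem val_ediv (i : Fin N) : (i.val : ℤ) / (N : ℤ) = 0 :=
  Int.ediv_eq_zero_of_lt (by omega) (by exact_mod_cast i.isLt)

theorem toFin_val_cast (i : Fin N) : toFin (((i.val : ℤ) : ℤ) : ZMod N) = i := by
  rw [Int.cast_natCast, toFin_cast]

theorem El_of_lt {i : Fin N} {k : ℕ} (h : i.val + k < N) :
    El N i.val (i.val + k) = 1 ⊗ₜ E i (rot i k) ∧
      El N (i.val + k) i.val = 1 ⊗ₜ E (rot i k) i := by
  have h' : ((i.val : ℤ) + k) / (N : ℤ) = 0 :=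
    Int.ediv_eq_zero_of_lt (by omega) (by exact_mod_cast h)
  simp only [El, toFin_add, toFin_val_cast, val_ediv, h', sub_self, LaurentPolynomial.T_zero,
    and_self]

theorem El_of_ge {i : Fin N} {k : ℕ} (hk : k < N) (h : ¬i.val + k < N) :
    El N i.val (i.val + k) = LaurentPolynomial.T 1 ⊗ₜ E i (rot i k) ∧
      El N (i.val + k) i.val = LaurentPolynomial.T (-1) ⊗ₜ E (rot i k) i := by
  have h' : ((i.val : ℤ) + k) / (N : ℤ) = 1 := by
    have hi := i.isLt
    rw [show (i.val : ℤ) + k = ((i.val + k - N : ℕ) : ℤ) + 1 * N by omega, add_mul_ediv,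
      Int.ediv_eq_zero_of_lt (by omega) (by omega), zero_add]
  simp only [El, toFin_add, toFin_val_cast, val_ediv, h', sub_zero, zero_sub, and_self]

theorem sTilde_of_lt (i : Fin N) {k : ℕ} (h0 : 0 < k) (hk : k < N) :
    sTilde i k = El N i.val (i.val + k) + (-1 : ℂ) ^ (k + 1) • El N (i.val + k) i.val := by
  simp only [sTilde, Nat.div_eq_of_lt hk, Nat.mod_eq_of_lt hk, h0.ne', if_false, if_true]
  by_cases h : i.val + k < N
  · rw [if_pos h, (El_of_lt h).1, (El_of_lt h).2]
  · rw [if_neg h, (El_of_ge hk h).1, (El_of_ge hk h).2]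

theorem sTilde_mul (i : Fin N) (m : ℕ) : sTilde i (N * m) = U N m ⊗ₜ H i := by
  simp only [sTilde, Nat.mul_mod_right, if_true, Nat.mul_div_cancel_left m (NeZero.pos N)]

theorem sTilde_mul_add (i : Fin N) {m k : ℕ} (hm : 0 < m) (h0 : 0 < k) (hk : k < N) :
    sTilde i (N * m + k) =
      U N m • (El N i.val (i.val + k) + (-1 : ℂ) ^ k • El N (i.val + k) i.val) := by
  have e1 : (N * m + k) / N = m := by
    rw [Nat.mul_add_div (NeZero.pos N), Nat.div_eq_of_lt hk, add_zero]
  have e2 : (N * m + k) % N = k := by rw [Nat.mul_add_mod, Nat.mod_eq_of_lt hk]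
  simp only [sTilde, e1, e2, h0.ne', hm.ne', if_false]
  rw [smul_add, smul_comm]
  by_cases h : i.val + k < N
  · rw [if_pos h, (El_of_lt h).1, (El_of_lt h).2, loop_smul_tmul, loop_smul_tmul, mul_one]
  · rw [if_neg h, (El_of_ge hk h).1, (El_of_ge hk h).2, loop_smul_tmul, loop_smul_tmul]

theorem El_rot (i : Fin N) (k : ℤ) :
    El N (rot i 1).val ((rot i 1).val + k) = El N (i.val + 1) (i.val + 1 + k) ∧
      El N ((rot i 1).val + k) (rot i 1).val = El N (i.val + 1 + k) (i.val + 1) := by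
  have h : ((rot i 1).val : ℤ) = (i.val + 1) + -(((i.val : ℤ) + 1) / N) * N := by
    have h' : ((rot i 1).val : ℤ) = ((i.val : ℤ) + 1) % N := by
      simp [rot]
    rw [h']
    linarith [Int.emod_add_mul_ediv ((i.val : ℤ) + 1) N]
  rw [h, add_right_comm _ _ k, El_shift, El_shift]
  exact ⟨rfl, rfl⟩

section
variable (h1 : (1 : ZMod N) ≠ 0) (h2 : (2 : ZMod N) ≠ 0)
include h1

theorem lie_sTilde_one_units (i : ℤ) (s : ℂ) {k : ℕ} (h0 : 0 < k) (hk : k + 1 < N) :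
    ⁅El N i (i + 1) + El N (i + 1) i, El N (i + 1) (i + 1 + k) + s • El N (i + 1 + k) (i + 1)⁆ =
      El N i (i + 1 + k) + s • -El N (i + 1 + k) i := by
  have d1 := cast_ne_cast_succ h1 i
  have d2 : ((i + 1 : ℤ) : ZMod N) ≠ ((i + 1 + k : ℤ) : ZMod N) := by
    push_cast
    simpa using natCast_ne_zero h0 (by omega)
  have d3 : (i : ZMod N) ≠ ((i + 1 + k : ℤ) : ZMod N) := by
    have := natCast_ne_zero (k := k + 1) (by omega) hk
    push_cast at this ⊢
    exact fun h => this (by linear_combination -h)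
  have e : ⁅El N (i + 1) i, El N (i + 1 + k) (i + 1)⁆ = -El N (i + 1 + k) i := by
    rw [← lie_skew, lie_El d2.symm d1.symm d3.symm]
  exact lie_add_smul_eq s (lie_El d1 d2 d3) (lie_El_of_ne d2 d1) (lie_El_of_ne d1 d2) e

/-- The string closes up around the cycle. The sign `s` decides the outcome: `s = (-1) ^ N` produces
`U N 1`, and `s = -(-1) ^ N` produces the factor leading from `U N m` to `U N (m + 1)`. -/
theorem lie_sTilde_one_imag (i : Fin N) (s : ℂ) {k : ℕ} (hk : k + 1 = N) :
    ⁅El N i.val (i.val + 1) + El N (i.val + 1) i.val,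
        El N (i.val + 1) (i.val + 1 + k) + s • El N (i.val + 1 + k) (i.val + 1)⁆ =
      (LaurentPolynomial.T 1 - s • LaurentPolynomial.T (-1)) ⊗ₜ H i := by
  have d1 := cast_ne_cast_succ h1 (i.val : ℤ)
  have hc : ((((i.val : ℤ) + 1 + k : ℤ)) : ZMod N) = ((i.val : ℤ) : ZMod N) := by
    have : ((k + 1 : ℕ) : ZMod N) = 0 := by rw [hk]; simp
    push_cast at this ⊢
    linear_combination this
  have hi : (i.val : ℤ) + 1 + k = i.val + 1 * N := by
    have hkz : (k : ℤ) + 1 = N := by exact_mod_cast hk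
    linarith
  have hr : toFin (((i.val : ℤ) + 1 : ℤ) : ZMod N) = rot i 1 := by
    have := toFin_add i 1
    rwa [Nat.cast_one] at this
  have e1 : ⁅El N i.val (i.val + 1), El N (i.val + 1) (i.val + 1 + k)⁆ =
      LaurentPolynomial.T 1 ⊗ₜ H i := by
    rw [hi, lie_El_imag 1 d1, toFin_val_cast, hr, H]
  have e2 : ⁅El N (i.val + 1) i.val, El N (i.val + 1 + k) (i.val + 1)⁆ =
      -(LaurentPolynomial.T (-1) ⊗ₜ H i) := by
    have hs := El_shift (N := N) (i.val + 1 * N) (i.val + 1) (-1)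
    rw [show (i.val : ℤ) + 1 * N + -1 * N = i.val by ring] at hs
    rw [hi, ← hs, lie_El_imag (-1) d1.symm, toFin_val_cast, hr, H, ← TensorProduct.tmul_neg]
    congr 1
    apply Subtype.ext
    change _ = -(singleSubSingle i (rot i 1) (1 : ℂ)).val
    rw [LieAlgebra.SpecialLinear.val_singleSubSingle, LieAlgebra.SpecialLinear.val_singleSubSingle,
      neg_sub]
  refine (lie_add_smul_eq s e1 (lie_El_of_ne (by rw [hc]; exact d1.symm) d1)
    (lie_El_of_ne d1 (by rw [hc]; exact d1.symm)) e2).trans ?_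
  rw [TensorProduct.sub_tmul, ← TensorProduct.smul_tmul', smul_neg, sub_eq_add_neg]

include h2

theorem lie_sTilde_one_H (i : Fin N) (u : ℂ[T;T⁻¹]) :
    ⁅El N i.val (i.val + 1) + El N (i.val + 1) i.val, u ⊗ₜ[ℂ] H (rot i 1)⁆ =
      u • (El N i.val (i.val + 1) + (-1 : ℂ) • El N (i.val + 1) i.val) := by
  have hr : toFin (((i.val : ℤ) + 1 : ℤ) : ZMod N) = rot i 1 := by
    have := toFin_add i 1
    rwa [Nat.cast_one] at this
  have hi : ∀ k : ℕ, rot i k = toFin ((i.val : ZMod N) + (k : ZMod N)) := fun k => by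
    conv_lhs => rw [← toFin_cast i, rot_toFin]
  have hrr : rot (rot i 1) 1 = toFin ((i.val : ZMod N) + 1 + 1) := by
    rw [hi 1, rot_toFin, Nat.cast_one]
  have n1 : i ≠ rot i 1 := by
    conv_lhs => rw [← toFin_cast i]
    rw [hi, Nat.cast_one]
    exact toFin_injective.ne (by simpa using h1)
  have n2 : rot i 1 ≠ rot (rot i 1) 1 := by
    rw [hrr, hi, Nat.cast_one]
    exact toFin_injective.ne (by simpa using h1)
  have n3 : i ≠ rot (rot i 1) 1 := by
    rw [hrr]
    conv_lhs => rw [← toFin_cast i]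
    exact toFin_injective.ne fun h => h2 (by linear_combination -h)
  have e1 : ⁅El N i.val (i.val + 1), u ⊗ₜ[ℂ] H (rot i 1)⁆ = u • El N i.val (i.val + 1) := by
    rw [El, hr, toFin_val_cast, LieAlgebra.ExtendScalars.bracket_tmul, lie_E_H n1 n2 n3,
      TensorProduct.smul_tmul', smul_eq_mul, mul_comm]
  have e2 : ⁅El N (i.val + 1) i.val, u ⊗ₜ[ℂ] H (rot i 1)⁆ = -(u • El N (i.val + 1) i.val) := by
    rw [El, hr, toFin_val_cast, LieAlgebra.ExtendScalars.bracket_tmul, lie_E_H' n1 n2 n3,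
      TensorProduct.smul_tmul', smul_eq_mul, mul_comm, TensorProduct.tmul_neg]
  have e3 : (-1 : ℂ) • El N (i.val + 1) i.val = -El N (i.val + 1) i.val := by module
  rw [loop_add_lie, e1, e2, e3, smul_add, smul_neg]

end

omit [NeZero N] in
theorem U_one : U N 1 = LaurentPolynomial.T 1 - ((-1 : ℂ) ^ N) • LaurentPolynomial.T (-1) := by
  rw [U, Nat.sub_self, pow_zero, mul_one, LaurentPolynomial.smul_eq_C_mul]
  simp

omit [NeZero N] in
theorem U_succ {m : ℕ} (hm : 0 < m) : U N (m + 1) =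
    U N m * (LaurentPolynomial.T 1 + ((-1 : ℂ) ^ N) • LaurentPolynomial.T (-1)) := by
  obtain ⟨m, rfl⟩ : ∃ l, m = l + 1 := ⟨m - 1, by omega⟩
  rw [U, U, Nat.add_sub_cancel, Nat.add_sub_cancel, pow_succ, ← mul_assoc,
    LaurentPolynomial.smul_eq_C_mul]
  simp

theorem sTilde_one (hN : 1 < N) (i : Fin N) :
    sTilde i 1 = El N i.val (i.val + 1) + El N (i.val + 1) i.val := by
  rw [sTilde_of_lt i one_pos hN, Nat.cast_one]
  norm_num

/-- Write `r = N * m + k`. The string leaves the diagonal for `k = 0`, lengthens for `0 < k < N -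
1`, and returns to the diagonal for `k = N - 1`. The Laurent factor `U N m` is central for the
bracket and pulls out. -/
theorem lie_sTilde (hN : 3 ≤ N) (i : Fin N) {r : ℕ} (hr : 0 < r) :
    ⁅sTilde i 1, sTilde (rot i 1) r⁆ = sTilde i (r + 1) := by
  have h1 : (1 : ZMod N) ≠ 0 := by simpa using natCast_ne_zero (k := 1) one_pos (by omega : 1 < N)
  have h2 : (2 : ZMod N) ≠ 0 := by simpa using natCast_ne_zero (k := 2) two_pos (by omega : 2 < N)
  obtain ⟨m, k, hk, rfl⟩ : ∃ m k, k < N ∧ r = N * m + k :=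
    ⟨r / N, r % N, Nat.mod_lt _ (by omega), (Nat.div_add_mod r N).symm⟩
  rw [sTilde_one (by omega)]
  rcases Nat.eq_zero_or_pos k with rfl | h0
  · have hm : 0 < m := Nat.pos_of_ne_zero fun h => by simp [h] at hr
    rw [add_zero, sTilde_mul, sTilde_mul_add i hm one_pos (by omega), lie_sTilde_one_H h1 h2,
      pow_one, Nat.cast_one]
  rcases Nat.lt_or_ge (k + 1) N with hk1 | hk1
  · have e : (i.val : ℤ) + ((k + 1 : ℕ) : ℤ) = i.val + 1 + k := by push_cast; ring
    rcases Nat.eq_zero_or_pos m with rfl | hm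
    · rw [mul_zero, zero_add, sTilde_of_lt _ h0 hk, sTilde_of_lt i (by omega) hk1, (El_rot i k).1,
        (El_rot i k).2, lie_sTilde_one_units h1 _ _ h0 hk1, e, pow_succ _ (k + 1)]
      module
    · rw [add_assoc, sTilde_mul_add _ hm h0 hk, sTilde_mul_add i hm (by omega) hk1, (El_rot i k).1,
        (El_rot i k).2, loop_lie_smul, lie_sTilde_one_units h1 _ _ h0 hk1, e, pow_succ _ k]
      congr 1
      module
  · have hkN : k + 1 = N := by omega
    rw [add_assoc, hkN, ← Nat.mul_succ, sTilde_mul]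
    rcases Nat.eq_zero_or_pos m with rfl | hm
    · rw [mul_zero, zero_add, sTilde_of_lt _ h0 hk, (El_rot i k).1, (El_rot i k).2,
        lie_sTilde_one_imag h1 i _ hkN, hkN, Nat.succ_eq_add_one, zero_add, U_one]
    · rw [sTilde_mul_add _ hm h0 hk, (El_rot i k).1, (El_rot i k).2, loop_lie_smul,
        lie_sTilde_one_imag h1 i _ hkN, Nat.succ_eq_add_one, U_succ hm, TensorProduct.smul_tmul',
        smul_eq_mul]
      congr 3
      have : (-1 : ℂ) ^ N = -(-1 : ℂ) ^ k := by rw [← hkN, pow_succ, mul_neg_one]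
      rw [this]
      module

theorem loopGen_eq (hN : 1 < N) {h1 : (1 : ZMod N) ≠ 0} (i : Fin N) :
    (loopGen h1 (i.val : ZMod N) : LoopSl N) = Complex.I • sTilde i 1 := by
  have h := loopGen_cast h1 (i.val : ℤ)
  rw [Int.cast_natCast] at h
  rw [h, loopRoot, sTilde_one hN, add_sub_cancel_left, sub_add_cancel_left, zpow_one, zpow_neg_one,
    Complex.inv_I]
  module

end Strings

end SlOnsager

theorem mainTheorem1 (N : ℕ) (hN : 3 ≤ N) :
    ∃ π : SlOnsager.OnsagerAlgebra N ≃ₗ⁅ℂ⁆ SlOnsager.fixedSubalgebra N,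
      (∀ i : Fin N,
        (π (SlOnsager.e i) : SlOnsager.LoopSl N) = SlOnsager.sTilde i 1) ∧
      (∀ φ : SlOnsager.OnsagerAlgebra N →ₗ⁅ℂ⁆ SlOnsager.fixedSubalgebra N,
        (∀ i : Fin N,
          (φ (SlOnsager.e i) : SlOnsager.LoopSl N) = SlOnsager.sTilde i 1) →
        φ = π.toLieHom) ∧
      (∀ (i : Fin N) (r : ℕ), 1 ≤ r →
        (π (SlOnsager.string i r) : SlOnsager.LoopSl N) = SlOnsager.sTilde i r) := by
  have : NeZero N := ⟨by omega⟩
  let P := SlOnsager.presentation N hN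
  obtain ⟨π, hπ⟩ := SlOnsager.exists_lift_of_isDolanGrady
    (SlOnsager.loopGen_isDolanGrady P.one_ne P.two_ne)
  have hbij : Function.Bijective π := SlOnsager.map_bijective P hπ
  have he : ∀ i : Fin N, (π (SlOnsager.e i) : SlOnsager.LoopSl N) = SlOnsager.sTilde i 1 := by
    intro i
    have h := congrArg (Subtype.val) (hπ (i.val : ZMod N))
    rw [SlOnsager.loopGen_eq (by omega), SlOnsager.toFin_cast, map_smul] at h
    -- The compact generators carry the same factor `Complex.I` on both sides, so it cancels.
    exact smul_right_injective _ Complex.I_ne_zero h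
  refine ⟨LieEquiv.ofBijective π hbij, he, fun φ hφ => ?_, fun i r hr => ?_⟩
  · refine SlOnsager.lieHom_ext fun i => Subtype.ext ?_
    exact (hφ i).trans (he i).symm
  · obtain ⟨r, rfl⟩ : ∃ s, r = s + 1 := ⟨r - 1, by omega⟩
    change (π (SlOnsager.string i (r + 1)) : SlOnsager.LoopSl N) = _
    clear hr
    induction r generalizing i with
    | zero => exact he i
    | succ r ih =>
      rw [SlOnsager.string, LieHom.map_lie]
      change ⁅(π (SlOnsager.e i) : SlOnsager.LoopSl N),
        (π (SlOnsager.string (SlOnsager.rot i 1) (r + 1)) : SlOnsager.LoopSl N)⁆ = _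
      rw [he, ih, SlOnsager.lie_sTilde hN i (Nat.succ_pos r)]
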